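/- **Setting.** Let $N\ge 1$, $d,q,n\in\mathbb N$, $X\in\mathbb R^{d\times n}$, $Y\in\mathbb R^{q\times n}$, $\lambda,\mu>0$, $\beta_1,\dots,\beta_N\in\mathbb R$, and let $\sigma_i:\mathbb R\to\mathbb R$, $1\le i\le N-1$, act entrywise on matrices. Write $\|\cdot\|_F$ for the Frobenius norm, $\langle A,B\rangle=\operatorname{tr}(AB^{\mathrm T})$, and $V_0:=X$. For block variables $\mathcal X=(\{W_i\}_{i=1}^N,\{U_i\}_{i=1}^{N-1},\{V_i\}_{i=1}^N,\{\Lambda_i\}_{i=1}^N)$ with $W_i\in\mathbb R^{d\times d}$, $U_i,V_i,\Lambda_i\in\mathbb R^{d\times n}$ for $i<N$, and $W_N\in\mathbb R^{q\times d}$, $V_N,\Lambda_N\in\mathbb R^{q\times n}$, let $$\begin{aligned}\mathcal L^{3s}_\beta(\mathcal X)={}&\tfrac12\|V_N-Y\|_F^2+\tfrac\lambda2\sum_{i=1}^N\|W_i\|_F^2+\tfrac\mu2\sum_{i=1}^{N-1}\|V_{i-1}+\sigma_i(U_i)-V_i\|_F^2\\&+\sum_{i=1}^{N-1}\Big(\langle\Lambda_i,W_iV_{i-1}-U_i\rangle+\tfrac{\beta_i}2\|W_iV_{i-1}-U_i\|_F^2\Big)\\&+\langle\Lambda_N,W_NV_{N-1}-V_N\rangle+\tfrac{\beta_N}2\|W_NV_{N-1}-V_N\|_F^2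 .\end{aligned}$$ **Algorithms.** The serial 3-splitting proximal point ADMM, with proximal parameters $\omega_i^k$ ($1\le i\le N-1$, $k\ge0$), starts from arbitrary $W_i^0$, with $U_i^0=W_i^0V_{i-1}^0$ and $V_i^0=V_{i-1}^0+\sigma_i(U_i^0)$ for $i<N$, $V_N^0=W_N^0V_{N-1}^0$, and $\Lambda_i^0=O$ for all $i$ (with $V_0^k=X$ for all $k$). For each $k\ge1$ it updates the blocks in the order $W_N,W_{N-1},\dots,W_1,U_1,V_1,\dots,U_{N-1},V_{N-1},V_N$. Each block is replaced by a minimizer of $\mathcal L^{3s}_\beta$ with respect to that block, the other blocks being fixed at their current values; for $U_i$ the term $\frac{\omega_i^{k-1}}2\|U_i-U_i^{k-1}\|_F^2$ is added to the objective. Finally $\Lambda_i^k=\Lambda_i^{k-1}+\beta_i(W_i^kV_{i-1}^k-U_i^k)$ for $i<N$ and $\Lambda_N^k=\Lambda_N^{k-1}+\beta_N(W_N^kV_{N-1}^k-V_N^k)$. In the parallel version, with the same initialization and the same updates of the $\Lambda_i$, processor $i$ handles the blocks with index $i$ and, using blocks retrieved from the processors $i-1$ and $i+1$, takes as new values minimizers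 of the following local problems ($i<N$ in the first two lines): $$\begin{aligned}W_i^k&:\ \tfrac\lambda2\|W\|_F^2+\tfrac{\beta_i}2\|WV_{i-1}^{k-1}-U_i^{k-1}+\tfrac1{\beta_i}\Lambda_i^{k-1}\|_F^2,\\ U_i^k&:\ \tfrac\mu2\|V_{i-1}^k+\sigma_i(U)-V_i^{k-1}\|_F^2+\tfrac{\beta_i}2\|U-W_i^kV_{i-1}^k-\tfrac1{\beta_i}\Lambda_i^{k-1}\|_F^2+\tfrac{\omega_i^{k-1}}2\|U-U_i^{k-1}\|_F^2,\\ V_i^k\ (i\le N-2)&:\ \tfrac\mu2\|V_{i-1}^k+\sigma_i(U_i^k)-V\|_F^2+\tfrac\mu2\|V+\sigma_{i+1}(U_{i+1}^{k-1})-V_{i+1}^{k-1}\|_F^2\\&\quad\ +\tfrac{\beta_{i+1}}2\|W_{i+1}^kV-U_{i+1}^{k-1}+\tfrac1{\beta_{i+1}}\Lambda_{i+1}^{k-1}\|_F^2,\\ V_{N-1}^k\ (N\ge2)&:\ \tfrac\mu2\|V-V_{N-2}^k-\sigma_{N-1}(U_{N-1}^k)\|_F^2+\tfrac{\beta_N}2\|W_N^kV-V_N^{k-1}+\tfrac1{\beta_N}\Lambda_N^{k-1}\|_F^2,\\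 W_N^k&:\ \tfrac\lambda2\|W\|_F^2+\tfrac{\beta_N}2\|WV_{N-1}^{k-1}-V_N^{k-1}+\tfrac1{\beta_N}\Lambda_N^{k-1}\|_F^2,\\ V_N^k&:\ \tfrac12\|V-Y\|_F^2+\tfrac{\beta_N}2\|V-W_N^kV_{N-1}^k-\tfrac1{\beta_N}\Lambda_N^{k-1}\|_F^2.\end{aligned}$$ **Assumptions.** 1. Each $\sigma_i$ is real analytic, and there are $\psi_0,\psi_1,\psi_2>0$ with $|\sigma_i|\le\psi_0$, $|\sigma_i'|\le\psi_1$, $|\sigma_i''|\le\psi_2$ on $\mathbb R$ for all $i\le N-1$. 2. There are $\mathcal V_0^{\max}>\|X\|_F$ and $\mathcal V_1^{\max},\dots,\mathcal V_{N-1}^{\max}>0$ such that, with $M_i:=\mu(\psi_0\psi_2+\psi_1^2+\mathcal V_i^{\max}\psi_2+\mathcal V_{i-1}^{\max}\psi_2)$, one has $\beta_i>\max\{32(1+\sqrt2)M_i,\,16\mu\psi_1^2\}$ for $i\le N-1$, and $\beta_N>1$. 3. Put $\Delta_i:=(\frac{\beta_i}4-8M_i)^2-128M_i^2$. For each $i\le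 N-1$ there are $\hat\epsilon_i\in(0,\frac{\sqrt{\Delta_i}}{32})$ and $\epsilon_i\in(0,\frac{\omega_i^{\min}}4)$ such that $\omega_i^{\min}<\omega_i^k\le\omega_i^{k+1}<\omega_i^{\max}$ for all $k\ge0$, where $$\omega_i^{\min}=\frac{\frac{\beta_i}4-8M_i-\sqrt{\Delta_i}}{16}+\hat\epsilon_i,\qquad \omega_i^{\max}=\min\left\{\frac{\frac{\beta_i}4-8M_i+\sqrt{\Delta_i}}{16}-\hat\epsilon_i,\ \sqrt{(\omega_i^{\min})^2+\frac{\beta_i\omega_i^{\min}}{16}-\frac{\beta_i\epsilon_i}4}\right\}.$$ 4. $\{\mathcal X^k\}_{k\ge0}$ is a sequence generated by the serial or by the parallel algorithm, and $\|V_i^k\|_F\le\mathcal V_i^{\max}$ for all $1\le i\le N-1$ and $k\ge0$. **Theorem.** Under these assumptions, where $\nabla$ denotes the gradient with respect to all block variables: (1) there exists $c>0$ such that $\displaystyle\frac1k\sum_{l=1}^k\|\nabla\mathcal L^{3s}_\beta(\mathcal X^l)\|_F\le\frac c{\sqrt k}$ for all $k\ge1$; (2) there exists $c>0$ such that $\displaystyle\min_{1\le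 l\le k}\|\nabla\mathcal L^{3s}_\beta(\mathcal X^l)\|_F\le\frac c{\sqrt k}$ for all $k\ge1$. -/

import Mathlib

open scoped Matrix Matrix.Norms.Frobenius

noncomputable section

namespace ResNetADMM

/-! Throughout, `H` is the number of hidden (residual) layers, so the network has `N = H + 1`
layers.  The hidden layer number `i = 1, …, N - 1` is the element `i - 1` of `Fin H`, and the
objects attached to the output layer `N` (which have different matrix sizes) are kept apart.
The norm `‖A‖` of a matrix is its Frobenius norm. -/

/-- The Frobenius inner product `⟨A, B⟩ = tr (A Bᵀ)`. -/
def frobInner {a b : ℕ} (A B : Matrix (Fin a) (Fin b) ℝ) : ℝ :=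
  (A * Bᵀ).trace

/-- The data of the 3-splitting relaxation and of its augmented Lagrangian: input `X`, target `Y`,
parameters `lam`, `mu`, penalty parameters `β` (hidden layers) and `βN` (output layer), and the
activation functions of the hidden layers. -/
structure Problem (H d q n : ℕ) where
  X : Matrix (Fin d) (Fin n) ℝ
  Y : Matrix (Fin q) (Fin n) ℝ
  lam : ℝ
  mu : ℝ
  β : Fin H → ℝ
  βN : ℝ
  σ : Fin H → ℝ → ℝ

/-- The block variables `({W_i}_{i ≤ N}, {U_i}_{i ≤ N-1}, {V_i}_{i ≤ N}, {Λ_i}_{i ≤ N})`. -/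
@[ext] structure Vars (H d q n : ℕ) where
  W : Fin H → Matrix (Fin d) (Fin d) ℝ
  WN : Matrix (Fin q) (Fin d) ℝ
  U : Fin H → Matrix (Fin d) (Fin n) ℝ
  V : Fin H → Matrix (Fin d) (Fin n) ℝ
  VN : Matrix (Fin q) (Fin n) ℝ
  Λ : Fin H → Matrix (Fin d) (Fin n) ℝ
  ΛN : Matrix (Fin q) (Fin n) ℝ

/-- The matrices `V_0, V_1, …, V_{N-1}`, where `V_0 = X` is the network input.  For a hidden layer
`i : Fin H`, its own output is `layer X x i.succ = x.V i`, and its input is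
`layer X x i.castSucc`.  The input of the output layer is `layer X x (Fin.last H)`. -/
def layer {H d q n : ℕ} (X : Matrix (Fin d) (Fin n) ℝ) (x : Vars H d q n) :
    Fin (H + 1) → Matrix (Fin d) (Fin n) ℝ :=
  Fin.cons (α := fun _ => Matrix (Fin d) (Fin n) ℝ) X x.V

/-- The augmented Lagrangian of the 3-splitting relaxation. -/
def Problem.lagrangian {H d q n : ℕ} (P : Problem H d q n) (x : Vars H d q n) : ℝ :=
  1 / 2 * ‖x.VN - P.Y‖ ^ 2
    + P.lam / 2 * ((∑ i, ‖x.W i‖ ^ 2) + ‖x.WN‖ ^ 2)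
    + P.mu / 2 * ∑ i, ‖layer P.X x i.castSucc + (x.U i).map (P.σ i) - x.V i‖ ^ 2
    + ∑ i, (frobInner (x.Λ i) (x.W i * layer P.X x i.castSucc - x.U i)
        + P.β i / 2 * ‖x.W i * layer P.X x i.castSucc - x.U i‖ ^ 2)
    + frobInner x.ΛN (x.WN * layer P.X x (Fin.last H) - x.VN)
    + P.βN / 2 * ‖x.WN * layer P.X x (Fin.last H) - x.VN‖ ^ 2

/-! ### The gradient -/

/-- The scalar coordinates of the block variables, in the order `W, WN, U, V, VN, Λ, ΛN`. -/
abbrev Coord (H d q n : ℕ) : Type :=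
  (Fin H × Fin d × Fin d) ⊕ (Fin q × Fin d) ⊕ (Fin H × Fin d × Fin n) ⊕
    (Fin H × Fin d × Fin n) ⊕ (Fin q × Fin n) ⊕ (Fin H × Fin d × Fin n) ⊕ (Fin q × Fin n)

/-- The block variables as one Euclidean vector; its Euclidean norm is the Frobenius norm of the
whole collection of blocks. -/
def Vars.toVec {H d q n : ℕ} (x : Vars H d q n) : EuclideanSpace ℝ (Coord H d q n) :=
  WithLp.toLp 2 <|
    Sum.elim (fun p => x.W p.1 p.2.1 p.2.2) <|
    Sum.elim (fun p => x.WN p.1 p.2) <|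
    Sum.elim (fun p => x.U p.1 p.2.1 p.2.2) <|
    Sum.elim (fun p => x.V p.1 p.2.1 p.2.2) <|
    Sum.elim (fun p => x.VN p.1 p.2) <|
    Sum.elim (fun p => x.Λ p.1 p.2.1 p.2.2) (fun p => x.ΛN p.1 p.2)

/-- The block variables with the given scalar coordinates. -/
def Vars.ofVec {H d q n : ℕ} (z : EuclideanSpace ℝ (Coord H d q n)) : Vars H d q n where
  W i := Matrix.of fun a b => z (.inl (i, a, b))
  WN := Matrix.of fun a b => z (.inr (.inl (a, b)))
  U i := Matrix.of fun a b => z (.inr (.inr (.inl (i, a, b))))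
  V i := Matrix.of fun a b => z (.inr (.inr (.inr (.inl (i, a, b)))))
  VN := Matrix.of fun a b => z (.inr (.inr (.inr (.inr (.inl (a, b))))))
  Λ i := Matrix.of fun a b => z (.inr (.inr (.inr (.inr (.inr (.inl (i, a, b)))))))
  ΛN := Matrix.of fun a b => z (.inr (.inr (.inr (.inr (.inr (.inr (a, b)))))))

theorem Vars.ofVec_toVec {H d q n : ℕ} (x : Vars H d q n) : Vars.ofVec x.toVec = x := rfl

/-- `‖∇ L(x)‖_F`, the gradient being taken with respect to all block variables. -/
def Problem.gradNorm {H d q n : ℕ} (P : Problem H d q n) (x : Vars H d q n) : ℝ :=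
  ‖gradient (fun z => P.lagrangian (Vars.ofVec z)) x.toVec‖

/-! ### The algorithms

In both step relations `x` is the previous iterate `X^{k-1}`, `y` is the new iterate `X^k`, and
`ω i` is the proximal parameter `ω_i^{k-1}`. -/

/-- Initialization: the weights are arbitrary, `U` and `V` come from a forward pass, and the dual
variables vanish. -/
structure Problem.IsInit {H d q n : ℕ} (P : Problem H d q n) (x : Vars H d q n) : Prop where
  U : ∀ i, x.U i = x.W i * layer P.X x i.castSucc
  V : ∀ i, x.V i = layer P.X x i.castSucc + (x.U i).map (P.σ i)
  VN : x.VN = x.WN * layer P.X x (Fin.last H)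
  Λ : ∀ i, x.Λ i = 0
  ΛN : x.ΛN = 0

/-- The updates of the dual variables. -/
structure Problem.DualStep {H d q n : ℕ} (P : Problem H d q n) (x y : Vars H d q n) : Prop where
  Λ : ∀ i, y.Λ i = x.Λ i + P.β i • (y.W i * layer P.X y i.castSucc - y.U i)
  ΛN : y.ΛN = x.ΛN + P.βN • (y.WN * layer P.X y (Fin.last H) - y.VN)

/-- One sweep of the serial algorithm: the Gauss-Seidel sweep
`W_N, W_{N-1}, …, W_1, U_1, V_1, U_2, V_2, …, U_{N-1}, V_{N-1}, V_N`, where each block is replaced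
by a minimizer of the augmented Lagrangian in that block, with all blocks updated earlier in the
sweep at their new values and all others at their old values (and with a proximal term for the
`U_i`), followed by the dual updates. -/
structure Problem.SerialStep {H d q n : ℕ} (P : Problem H d q n) (ω : Fin H → ℝ)
    (x y : Vars H d q n) : Prop where
  WN : IsMinOn (fun A => P.lagrangian { x with WN := A }) Set.univ y.WN
  W : ∀ i, IsMinOn
    (fun A => P.lagrangian
      { x with
        WN := y.WN
        W := Function.update (fun j => if i < j then y.W j else x.W j) i A })
    Set.univ (y.W i)
  U : ∀ i, IsMinOn
    (fun A => P.lagrangian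
      { x with
        WN := y.WN
        W := y.W
        U := Function.update (fun j => if j < i then y.U j else x.U j) i A
        V := fun j => if j < i then y.V j else x.V j }
      + ω i / 2 * ‖A - x.U i‖ ^ 2)
    Set.univ (y.U i)
  V : ∀ i, IsMinOn
    (fun A => P.lagrangian
      { x with
        WN := y.WN
        W := y.W
        U := fun j => if j ≤ i then y.U j else x.U j
        V := Function.update (fun j => if j < i then y.V j else x.V j) i A })
    Set.univ (y.V i)
  VN : IsMinOn
    (fun A => P.lagrangian
      { x with
        WN := y.WN
        W := y.W
        U := y.U
        V := y.V
        VN := A })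
    Set.univ y.VN
  dual : P.DualStep x y

/-- One round of the parallel algorithm: the processor of each layer solves its local subproblems
in terms of its own blocks and of the blocks retrieved from the processors of the two neighbouring
layers: `V_{i-1}` at its new value from the previous layer; from the next layer, `W_{i+1}` at its
new value, and `U_{i+1}`, `V_{i+1}`, `Λ_{i+1}` at their old values. -/
structure Problem.ParallelStep {H d q n : ℕ} (P : Problem H d q n) (ω : Fin H → ℝ)
    (x y : Vars H d q n) : Prop where
  W : ∀ i, IsMinOn
    (fun A => P.lam / 2 * ‖A‖ ^ 2
      + P.β i / 2 * ‖A * layer P.X x i.castSucc - x.U i + (1 / P.β i) • x.Λ i‖ ^ 2)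
    Set.univ (y.W i)
  WN : IsMinOn
    (fun A => P.lam / 2 * ‖A‖ ^ 2
      + P.βN / 2 * ‖A * layer P.X x (Fin.last H) - x.VN + (1 / P.βN) • x.ΛN‖ ^ 2)
    Set.univ y.WN
  U : ∀ i, IsMinOn
    (fun A => P.mu / 2 * ‖layer P.X y i.castSucc + A.map (P.σ i) - x.V i‖ ^ 2
      + P.β i / 2 * ‖A - y.W i * layer P.X y i.castSucc - (1 / P.β i) • x.Λ i‖ ^ 2
      + ω i / 2 * ‖A - x.U i‖ ^ 2)
    Set.univ (y.U i)
  V : ∀ i j : Fin H, (i : ℕ) + 1 = j → IsMinOn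
    (fun A => P.mu / 2 * ‖layer P.X y i.castSucc + (y.U i).map (P.σ i) - A‖ ^ 2
      + P.mu / 2 * ‖A + (x.U j).map (P.σ j) - x.V j‖ ^ 2
      + P.β j / 2 * ‖y.W j * A - x.U j + (1 / P.β j) • x.Λ j‖ ^ 2)
    Set.univ (y.V i)
  V_last : ∀ i : Fin H, (i : ℕ) + 1 = H → IsMinOn
    (fun A => P.mu / 2 * ‖A - layer P.X y i.castSucc - (y.U i).map (P.σ i)‖ ^ 2
      + P.βN / 2 * ‖y.WN * A - x.VN + (1 / P.βN) • x.ΛN‖ ^ 2)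
    Set.univ (y.V i)
  VN : IsMinOn
    (fun A => 1 / 2 * ‖A - P.Y‖ ^ 2
      + P.βN / 2 * ‖A - y.WN * layer P.X y (Fin.last H) - (1 / P.βN) • x.ΛN‖ ^ 2)
    Set.univ y.VN
  dual : P.DualStep x y

/-- `x` is a sequence of iterates `X^0, X^1, …` of the serial 3-splitting proximal point ADMM, with
proximal parameters `ω k i = ω_i^k`. -/
structure Problem.IsSerialRun {H d q n : ℕ} (P : Problem H d q n) (ω : ℕ → Fin H → ℝ)
    (x : ℕ → Vars H d q n) : Prop where
  init : P.IsInit (x 0)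
  step : ∀ k, P.SerialStep (ω k) (x k) (x (k + 1))

/-- `x` is a sequence of iterates `X^0, X^1, …` of the parallel 3-splitting proximal point ADMM,
with proximal parameters `ω k i = ω_i^k`. -/
structure Problem.IsParallelRun {H d q n : ℕ} (P : Problem H d q n) (ω : ℕ → Fin H → ℝ)
    (x : ℕ → Vars H d q n) : Prop where
  init : P.IsInit (x 0)
  step : ∀ k, P.ParallelStep (ω k) (x k) (x (k + 1))

/-! ### The assumptions

`ψ₀ ψ₁ ψ₂` bound the activation functions and their first two derivatives, and `Vmax j` bounds
`V_j` for `j = 0, …, N - 1`. -/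

/-- The activation functions are real analytic, with bounded values and bounded first and second
derivatives. -/
structure Problem.ActivationAssumption {H d q n : ℕ} (P : Problem H d q n) (ψ₀ ψ₁ ψ₂ : ℝ) :
    Prop where
  pos₀ : 0 < ψ₀
  pos₁ : 0 < ψ₁
  pos₂ : 0 < ψ₂
  analytic : ∀ i, AnalyticOnNhd ℝ (P.σ i) Set.univ
  bound₀ : ∀ i t, |P.σ i t| ≤ ψ₀
  bound₁ : ∀ i t, |deriv (P.σ i) t| ≤ ψ₁
  bound₂ : ∀ i t, |deriv (deriv (P.σ i)) t| ≤ ψ₂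

/-- `μ (ψ₀ ψ₂ + ψ₁² + Vmax_i ψ₂ + Vmax_{i-1} ψ₂)`. -/
def Problem.modulus {H d q n : ℕ} (P : Problem H d q n) (ψ₀ ψ₁ ψ₂ : ℝ) (Vmax : Fin (H + 1) → ℝ)
    (i : Fin H) : ℝ :=
  P.mu * (ψ₀ * ψ₂ + ψ₁ ^ 2 + Vmax i.succ * ψ₂ + Vmax i.castSucc * ψ₂)

/-- Lower bounds on the penalty parameters. -/
structure Problem.PenaltyAssumption {H d q n : ℕ} (P : Problem H d q n) (ψ₀ ψ₁ ψ₂ : ℝ)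
    (Vmax : Fin (H + 1) → ℝ) : Prop where
  Vmax_zero : ‖P.X‖ < Vmax 0
  Vmax_pos : ∀ i : Fin H, 0 < Vmax i.succ
  β : ∀ i, max (32 * (1 + √2) * P.modulus ψ₀ ψ₁ ψ₂ Vmax i) (16 * P.mu * ψ₁ ^ 2) < P.β i
  βN : 1 < P.βN

/-- The discriminant `Δ_i`. -/
def Problem.disc {H d q n : ℕ} (P : Problem H d q n) (ψ₀ ψ₁ ψ₂ : ℝ) (Vmax : Fin (H + 1) → ℝ)
    (i : Fin H) : ℝ :=
  (P.β i / 4 - 8 * P.modulus ψ₀ ψ₁ ψ₂ Vmax i) ^ 2 - 128 * P.modulus ψ₀ ψ₁ ψ₂ Vmax i ^ 2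

/-- The lower bound `ω_i^min`, depending on `e' = ε̂_i`. -/
def Problem.ωmin {H d q n : ℕ} (P : Problem H d q n) (ψ₀ ψ₁ ψ₂ : ℝ) (Vmax : Fin (H + 1) → ℝ)
    (i : Fin H) (e' : ℝ) : ℝ :=
  (P.β i / 4 - 8 * P.modulus ψ₀ ψ₁ ψ₂ Vmax i - √(P.disc ψ₀ ψ₁ ψ₂ Vmax i)) / 16 + e'

/-- The upper bound `ω_i^max`, depending on `e' = ε̂_i` and `e = ε_i`. -/
def Problem.ωmax {H d q n : ℕ} (P : Problem H d q n) (ψ₀ ψ₁ ψ₂ : ℝ) (Vmax : Fin (H + 1) → ℝ)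
    (i : Fin H) (e' e : ℝ) : ℝ :=
  min ((P.β i / 4 - 8 * P.modulus ψ₀ ψ₁ ψ₂ Vmax i + √(P.disc ψ₀ ψ₁ ψ₂ Vmax i)) / 16 - e')
    √(P.ωmin ψ₀ ψ₁ ψ₂ Vmax i e' ^ 2 + P.β i * P.ωmin ψ₀ ψ₁ ψ₂ Vmax i e' / 16 - P.β i * e / 4)

/-- The proximal parameters are non-decreasing in `k` and lie strictly between `ω_i^min` and
`ω_i^max`. -/
structure Problem.ProximalAssumption {H d q n : ℕ} (P : Problem H d q n) (ψ₀ ψ₁ ψ₂ : ℝ)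
    (Vmax : Fin (H + 1) → ℝ) (ω : ℕ → Fin H → ℝ) (e' e : Fin H → ℝ) : Prop where
  e'_pos : ∀ i, 0 < e' i
  e'_lt : ∀ i, e' i < √(P.disc ψ₀ ψ₁ ψ₂ Vmax i) / 32
  e_pos : ∀ i, 0 < e i
  e_lt : ∀ i, e i < P.ωmin ψ₀ ψ₁ ψ₂ Vmax i (e' i) / 4
  lower : ∀ k i, P.ωmin ψ₀ ψ₁ ψ₂ Vmax i (e' i) < ω k i
  mono : ∀ k i, ω k i ≤ ω (k + 1) i
  upper : ∀ k i, ω k i < P.ωmax ψ₀ ψ₁ ψ₂ Vmax i (e' i) (e i)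

/-! ### Average and minimum -/

/-- The average of `f 1, …, f k`. -/
def avgUpTo (f : ℕ → ℝ) (k : ℕ) : ℝ :=
  1 / (k : ℝ) * ∑ l ∈ Finset.Icc 1 k, f l

/-- The minimum of `f 1, …, f k`, where `k ≥ 1`. -/
def minUpTo (f : ℕ → ℝ) (k : ℕ) (hk : 1 ≤ k) : ℝ :=
  (Finset.Icc 1 k).inf' (Finset.nonempty_Icc.mpr hk) f

end ResNetADMM

end

noncomputable section

namespace ResNetADMM

/-! ### The Frobenius inner product -/

section Frobenius

variable {a b c : ℕ}

/-! Both algorithms satisfy the same one-sweep relation `Problem.LocalStep`. A block occurs at most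
in the costs of its own layer and of the next one, so the serial and the parallel subproblems agree
up to constants once each penalty is completed to a square.

In a sweep every primal update lowers the augmented Lagrangian by a multiple of its squared
increment: `lam` and `mu` give strong convexity in the weights and in `V`, the output problem is
strongly convex, and the proximal term serves the nonconvex problem in `U`. The only increase is
`‖ΔΛ‖² / β` per layer, from the dual updates (`descent`). First order conditions control it: at the
output the multiplier is `VN - Y` (`dualN_eq`), and in a hidden layer it is an explicit function,
Lipschitz for bounded `V`, of the new input, the new `U` and the old `V`, plus `ω` times the
increment of `U` (`dual_eq`). So `‖ΔΛ‖²` is bounded by squared primal increments of the current and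
the preceding sweep (`norm_dual_sub_sq_le`).

The Lyapunov function stores multiples of the latest increments of `U` and `V`, which pay for that
lag. The parameter conditions leave every remaining coefficient positive: `ω` lies between the roots
of a quadratic, `β > 16 μ ψ₁²` serves `V`, and `βN > 1` the output. The function is bounded below,
so the squared primal increments are summable, and the weights and outputs stay bounded.

Each block is stationary for a problem that differs from the Lagrangian at the end of the sweep only
in blocks that were still old and in the proximal term. With everything bounded, the gradient is
therefore at most a constant times the increments, so its squares are summable. Cauchy-Schwarz gives
the rate for the average, and the minimum is at most the average. -/

theorem frobInner_eq_sum (A B : Matrix (Fin a) (Fin b) ℝ) :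
    frobInner A B = ∑ i, ∑ j, A i j * B i j := by
  simp [frobInner, Matrix.trace, Matrix.mul_apply]

theorem norm_sq_eq_frobInner (A : Matrix (Fin a) (Fin b) ℝ) : ‖A‖ ^ 2 = frobInner A A := by
  have h : (0 : ℝ) ≤ ∑ i, ∑ j, A i j * A i j :=
    Finset.sum_nonneg fun i _ => Finset.sum_nonneg fun j _ => mul_self_nonneg _
  rw [frobInner_eq_sum, Matrix.frobenius_norm_def, ← Real.sqrt_eq_rpow]
  simp only [Real.rpow_ofNat, Real.norm_eq_abs, sq_abs]
  simp only [← pow_two] at h ⊢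
  exact Real.sq_sqrt h

theorem frobInner_comm (A B : Matrix (Fin a) (Fin b) ℝ) : frobInner A B = frobInner B A := by
  simp only [frobInner_eq_sum, mul_comm]

theorem frobInner_add_left (A B C : Matrix (Fin a) (Fin b) ℝ) :
    frobInner (A + B) C = frobInner A C + frobInner B C := by
  simp [frobInner, Matrix.add_mul]

theorem frobInner_sub_left (A B C : Matrix (Fin a) (Fin b) ℝ) :
    frobInner (A - B) C = frobInner A C - frobInner B C := by
  simp [frobInner, Matrix.sub_mul]

theorem frobInner_smul_left (t : ℝ) (A B : Matrix (Fin a) (Fin b) ℝ) :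
    frobInner (t • A) B = t * frobInner A B := by
  simp [frobInner]

theorem frobInner_neg_left (A B : Matrix (Fin a) (Fin b) ℝ) :
    frobInner (-A) B = -frobInner A B := by
  simp [frobInner]

theorem frobInner_add_right (A B C : Matrix (Fin a) (Fin b) ℝ) :
    frobInner A (B + C) = frobInner A B + frobInner A C := by
  simp only [frobInner_comm A, frobInner_add_left]

theorem frobInner_sub_right (A B C : Matrix (Fin a) (Fin b) ℝ) :
    frobInner A (B - C) = frobInner A B - frobInner A C := by
  simp only [frobInner_comm A, frobInner_sub_left]

theorem frobInner_smul_right (t : ℝ) (A B : Matrix (Fin a) (Fin b) ℝ) :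
    frobInner A (t • B) = t * frobInner A B := by
  simp only [frobInner_comm A, frobInner_smul_left]

theorem frobInner_neg_right (A B : Matrix (Fin a) (Fin b) ℝ) :
    frobInner A (-B) = -frobInner A B := by
  simp only [frobInner_comm A, frobInner_neg_left]

theorem frobInner_zero_left (A : Matrix (Fin a) (Fin b) ℝ) : frobInner 0 A = 0 := by
  simp [frobInner]

theorem frobInner_zero_right (A : Matrix (Fin a) (Fin b) ℝ) : frobInner A 0 = 0 := by
  simp [frobInner]

theorem frobInner_mul_right (A : Matrix (Fin a) (Fin c) ℝ) (M : Matrix (Fin a) (Fin b) ℝ)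
    (B : Matrix (Fin b) (Fin c) ℝ) : frobInner A (M * B) = frobInner (Mᵀ * A) B := by
  rw [frobInner, frobInner, Matrix.transpose_mul, ← Matrix.mul_assoc, Matrix.trace_mul_comm,
    Matrix.mul_assoc]

theorem frobInner_mul_right' (A : Matrix (Fin a) (Fin c) ℝ) (B : Matrix (Fin a) (Fin b) ℝ)
    (M : Matrix (Fin b) (Fin c) ℝ) : frobInner A (B * M) = frobInner (A * Mᵀ) B := by
  rw [frobInner, frobInner, Matrix.transpose_mul, Matrix.mul_assoc]

theorem frobInner_hadamard_right (A B C : Matrix (Fin a) (Fin b) ℝ) :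
    frobInner A (B ⊙ C) = frobInner (A ⊙ B) C := by
  simp [frobInner_eq_sum, mul_assoc]

theorem abs_frobInner_le (A B : Matrix (Fin a) (Fin b) ℝ) : |frobInner A B| ≤ ‖A‖ * ‖B‖ := by
  refine abs_le_of_sq_le_sq ?_ (by positivity)
  rw [mul_pow, norm_sq_eq_frobInner, norm_sq_eq_frobInner]
  simp only [frobInner_eq_sum, ← Finset.sum_product', Finset.univ_product_univ, ← pow_two]
  exact Finset.sum_mul_sq_le_sq_mul_sq _ _ _

theorem norm_le_of_entry_le {A B : Matrix (Fin a) (Fin b) ℝ} {r : ℝ} (hr : 0 ≤ r)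
    (h : ∀ i j, |A i j| ≤ r * |B i j|) : ‖A‖ ≤ r * ‖B‖ := by
  refine le_of_sq_le_sq ?_ (by positivity)
  rw [mul_pow, norm_sq_eq_frobInner, norm_sq_eq_frobInner, frobInner_eq_sum, frobInner_eq_sum,
    Finset.mul_sum]
  refine Finset.sum_le_sum fun i _ => ?_
  rw [Finset.mul_sum]
  refine Finset.sum_le_sum fun j _ => ?_
  have := pow_le_pow_left₀ (abs_nonneg _) (h i j) 2
  rw [mul_pow, sq_abs, sq_abs] at this
  linarith

theorem abs_entry_le_norm (A : Matrix (Fin a) (Fin b) ℝ) (i : Fin a) (j : Fin b) :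
    |A i j| ≤ ‖A‖ := by
  refine abs_le_of_sq_le_sq ?_ (norm_nonneg _)
  rw [norm_sq_eq_frobInner, frobInner_eq_sum, pow_two]
  refine le_trans ?_ (Finset.single_le_sum (f := fun i => ∑ j, A i j * A i j)
    (fun i _ => Finset.sum_nonneg fun j _ => mul_self_nonneg _) (Finset.mem_univ i))
  exact Finset.single_le_sum (f := fun j => A i j * A i j)
    (fun j _ => mul_self_nonneg _) (Finset.mem_univ j)

theorem norm_hadamard_le_of_entry_le {A : Matrix (Fin a) (Fin b) ℝ} {r : ℝ} (hr : 0 ≤ r)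
    (h : ∀ i j, |A i j| ≤ r) (B : Matrix (Fin a) (Fin b) ℝ) : ‖A ⊙ B‖ ≤ r * ‖B‖ := by
  refine norm_le_of_entry_le hr fun i j => ?_
  rw [Matrix.hadamard_apply, abs_mul]
  exact mul_le_mul_of_nonneg_right (h i j) (abs_nonneg _)

/-- The all-ones matrix. -/
def ones (a b : ℕ) : Matrix (Fin a) (Fin b) ℝ := Matrix.of fun _ _ => 1

theorem norm_le_mul_norm_ones {A : Matrix (Fin a) (Fin b) ℝ} {r : ℝ} (hr : 0 ≤ r)
    (h : ∀ i j, |A i j| ≤ r) : ‖A‖ ≤ r * ‖ones a b‖ :=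
  norm_le_of_entry_le hr fun i j => by simpa [ones] using h i j

/-- If a functional has an exact second order expansion at a minimizer, with a quadratic remainder,
then its first order term vanishes. -/
theorem eq_zero_of_quadratic_min {F Q : Matrix (Fin a) (Fin b) ℝ → ℝ}
    {y G : Matrix (Fin a) (Fin b) ℝ} (hF : ∀ D, F (y + D) = F y + frobInner G D + Q D)
    (hQ : ∀ (t : ℝ) D, Q (t • D) = t ^ 2 * Q D) (hy : ∀ A, F y ≤ F A) : G = 0 := by
  -- Minimality along the line `y + t • G` makes this quadratic in `t` nonnegative; its discriminant
  -- is `‖G‖⁴`, which must then vanish.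
  have key : ∀ t : ℝ, 0 ≤ Q G * (t * t) + frobInner G G * t + 0 := fun t => by
    have := hy (y + t • G)
    rw [hF, hQ, frobInner_smul_right] at this
    nlinarith
  have := discrim_le_zero key
  rw [discrim, ← norm_sq_eq_frobInner] at this
  have h0 : (‖G‖ ^ 2) ^ 2 ≤ 0 := by linarith
  have h1 : ‖G‖ = 0 := by
    by_contra h
    have : 0 < (‖G‖ ^ 2) ^ 2 := by positivity
    linarith
  exact norm_eq_zero.mp h1

/-- The augmented Lagrangian term of one linear constraint with multiplier `Λ` and residual `R`. -/
def penalty (β : ℝ) (Λ R : Matrix (Fin a) (Fin b) ℝ) : ℝ :=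
  frobInner Λ R + β / 2 * ‖R‖ ^ 2

theorem penalty_add (β : ℝ) (Λ R D : Matrix (Fin a) (Fin b) ℝ) :
    penalty β Λ (R + D) = penalty β Λ R + frobInner (Λ + β • R) D + β / 2 * ‖D‖ ^ 2 := by
  simp only [penalty, norm_sq_eq_frobInner, frobInner_add_left, frobInner_add_right,
    frobInner_smul_left, frobInner_comm D R]
  ring

/-- Completing the square. It turns Lagrangian terms into the objectives of the parallel algorithm,
and it bounds a penalty from below by its multiplier alone. -/
theorem penalty_eq {β : ℝ} (hβ : β ≠ 0) (Λ R : Matrix (Fin a) (Fin b) ℝ) :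
    penalty β Λ R = β / 2 * ‖R + (1 / β) • Λ‖ ^ 2 - ‖Λ‖ ^ 2 / (2 * β) := by
  simp only [penalty, norm_sq_eq_frobInner, frobInner_add_left, frobInner_add_right,
    frobInner_smul_left, frobInner_smul_right, frobInner_comm Λ R]
  field_simp
  ring

theorem norm_sq_add (A D : Matrix (Fin a) (Fin b) ℝ) :
    ‖A + D‖ ^ 2 = ‖A‖ ^ 2 + 2 * frobInner A D + ‖D‖ ^ 2 := by
  simp only [norm_sq_eq_frobInner, frobInner_add_left, frobInner_add_right, frobInner_comm D A]
  ring

theorem norm_smul_sq (t : ℝ) (D : Matrix (Fin a) (Fin b) ℝ) :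
    ‖t • D‖ ^ 2 = t ^ 2 * ‖D‖ ^ 2 := by
  rw [norm_smul, mul_pow, Real.norm_eq_abs, sq_abs]

theorem norm_mul_mul_le (A : Matrix (Fin a) (Fin b) ℝ) (B : Matrix (Fin b) (Fin c) ℝ) :
    ‖A * B‖ ≤ ‖A‖ * ‖B‖ := Matrix.frobenius_norm_mul A B

end Frobenius

/-! ### Derivatives of matrix-valued maps, entry by entry -/

section Calculus

variable {E : Type*} [NormedAddCommGroup E] [NormedSpace ℝ E]

/-- `f` is Fréchet differentiable at `z`, with differential the function `f'`. -/
def HasDiff (f f' : E → ℝ) (z : E) : Prop :=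
  ∃ L : E →L[ℝ] ℝ, HasFDerivAt f L z ∧ ∀ v, L v = f' v

/-- `A` is entrywise Fréchet differentiable at `z`, with differential the function `A'`. -/
def HasMDiff {a b : ℕ} (A A' : E → Matrix (Fin a) (Fin b) ℝ) (z : E) : Prop :=
  ∀ i j, HasDiff (fun w => A w i j) (fun v => A' v i j) z

variable {a b c : ℕ} {z : E}

theorem HasDiff.const (r : ℝ) : HasDiff (fun _ : E => r) (fun _ => 0) z :=
  ⟨0, hasFDerivAt_const r z, fun _ => rfl⟩

/-- Since the differential is carried as a plain function, its formula can be rearranged by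
pointwise algebra. -/
theorem HasDiff.congr_diff {f f' g' : E → ℝ} (hf : HasDiff f f' z) (h : ∀ v, f' v = g' v) :
    HasDiff f g' z := by
  obtain ⟨L, hL, hL'⟩ := hf
  exact ⟨L, hL, fun v => (hL' v).trans (h v)⟩

theorem HasDiff.add {f f' g g' : E → ℝ} (hf : HasDiff f f' z) (hg : HasDiff g g' z) :
    HasDiff (fun w => f w + g w) (fun v => f' v + g' v) z := by
  obtain ⟨L, hL, hL'⟩ := hf
  obtain ⟨K, hK, hK'⟩ := hg
  exact ⟨L + K, hL.add hK, fun v => by simp [hL', hK']⟩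

theorem HasDiff.sub {f f' g g' : E → ℝ} (hf : HasDiff f f' z) (hg : HasDiff g g' z) :
    HasDiff (fun w => f w - g w) (fun v => f' v - g' v) z := by
  obtain ⟨L, hL, hL'⟩ := hf
  obtain ⟨K, hK, hK'⟩ := hg
  exact ⟨L - K, hL.sub hK, fun v => by simp [hL', hK']⟩

theorem HasDiff.mul {f f' g g' : E → ℝ} (hf : HasDiff f f' z) (hg : HasDiff g g' z) :
    HasDiff (fun w => f w * g w) (fun v => f' v * g z + f z * g' v) z := by
  obtain ⟨L, hL, hL'⟩ := hf
  obtain ⟨K, hK, hK'⟩ := hg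
  exact ⟨_, hL.mul hK, fun v => by simp [hL', hK']; ring⟩

theorem HasDiff.const_mul {f f' : E → ℝ} (r : ℝ) (hf : HasDiff f f' z) :
    HasDiff (fun w => r * f w) (fun v => r * f' v) z := by
  obtain ⟨L, hL, hL'⟩ := hf
  exact ⟨_, hL.const_mul r, fun v => by simp [hL']⟩

theorem HasDiff.sum {ι : Type*} (s : Finset ι) {f f' : ι → E → ℝ}
    (hf : ∀ i ∈ s, HasDiff (f i) (f' i) z) :
    HasDiff (fun w => ∑ i ∈ s, f i w) (fun v => ∑ i ∈ s, f' i v) z := by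
  classical
  choose! L hL hL' using hf
  refine ⟨∑ i ∈ s, L i, HasFDerivAt.fun_sum hL, fun v => ?_⟩
  rw [sum_apply]
  exact Finset.sum_congr rfl fun i hi => hL' i hi v

theorem HasDiff.comp_real {f f' : E → ℝ} {s : ℝ → ℝ} (hs : DifferentiableAt ℝ s (f z))
    (hf : HasDiff f f' z) : HasDiff (fun w => s (f w)) (fun v => deriv s (f z) * f' v) z := by
  obtain ⟨L, hL, hL'⟩ := hf
  exact ⟨_, hs.hasDerivAt.comp_hasFDerivAt z hL, fun v => by simp [hL']⟩

theorem HasDiff.clm (L : E →L[ℝ] ℝ) : HasDiff (fun w => L w) (fun v => L v) z :=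
  ⟨L, L.hasFDerivAt, fun _ => rfl⟩

theorem HasDiff.eq_zero_of_min {f f' : E → ℝ} (hf : HasDiff f f' z) (hz : ∀ w, f z ≤ f w)
    (v : E) : f' v = 0 := by
  obtain ⟨L, hL, hL'⟩ := hf
  have : IsLocalMin f z := Filter.Eventually.of_forall hz
  rw [← hL', this.hasFDerivAt_eq_zero hL]
  rfl

theorem HasMDiff.const (A : Matrix (Fin a) (Fin b) ℝ) :
    HasMDiff (fun _ : E => A) (fun _ => 0) z :=
  fun _ _ => HasDiff.const _

theorem HasMDiff.add {A A' B B' : E → Matrix (Fin a) (Fin b) ℝ} (hA : HasMDiff A A' z)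
    (hB : HasMDiff B B' z) : HasMDiff (fun w => A w + B w) (fun v => A' v + B' v) z :=
  fun i j => (hA i j).add (hB i j)

theorem HasMDiff.sub {A A' B B' : E → Matrix (Fin a) (Fin b) ℝ} (hA : HasMDiff A A' z)
    (hB : HasMDiff B B' z) : HasMDiff (fun w => A w - B w) (fun v => A' v - B' v) z :=
  fun i j => (hA i j).sub (hB i j)

theorem HasMDiff.mul {A A' : E → Matrix (Fin a) (Fin b) ℝ} {B B' : E → Matrix (Fin b) (Fin c) ℝ}
    (hA : HasMDiff A A' z) (hB : HasMDiff B B' z) :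
    HasMDiff (fun w => A w * B w) (fun v => A' v * B z + A z * B' v) z := fun i j => by
  simp only [Matrix.mul_apply, Matrix.add_apply, ← Finset.sum_add_distrib]
  exact HasDiff.sum _ fun l _ => (hA i l).mul (hB l j)

theorem HasMDiff.map {A A' : E → Matrix (Fin a) (Fin b) ℝ} {s : ℝ → ℝ} (hs : Differentiable ℝ s)
    (hA : HasMDiff A A' z) :
    HasMDiff (fun w => (A w).map s) (fun v => (A z).map (deriv s) ⊙ A' v) z :=
  fun i j => HasDiff.comp_real (hs _) (hA i j)

theorem HasMDiff.frobInner {A A' B B' : E → Matrix (Fin a) (Fin b) ℝ} (hA : HasMDiff A A' z)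
    (hB : HasMDiff B B' z) :
    HasDiff (fun w => frobInner (A w) (B w))
      (fun v => frobInner (B z) (A' v) + frobInner (A z) (B' v)) z := by
  simp only [frobInner_eq_sum, ← Finset.sum_add_distrib]
  exact HasDiff.sum _ fun i _ => HasDiff.sum _ fun j _ =>
    ((hA i j).mul (hB i j)).congr_diff fun v => by ring

theorem HasMDiff.half_norm_sq {A A' : E → Matrix (Fin a) (Fin b) ℝ} (r : ℝ)
    (hA : HasMDiff A A' z) :
    HasDiff (fun w => r / 2 * ‖A w‖ ^ 2) (fun v => r * ResNetADMM.frobInner (A z) (A' v)) z := by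
  simp only [norm_sq_eq_frobInner]
  exact ((hA.frobInner hA).const_mul _).congr_diff fun v => by ring

theorem HasMDiff.penalty {Λ Λ' R R' : E → Matrix (Fin a) (Fin b) ℝ} (β : ℝ)
    (hΛ : HasMDiff Λ Λ' z) (hR : HasMDiff R R' z) :
    HasDiff (fun w => penalty β (Λ w) (R w))
      (fun v => ResNetADMM.frobInner (R z) (Λ' v)
        + ResNetADMM.frobInner (Λ z + β • R z) (R' v)) z :=
  ((hΛ.frobInner hR).add (hR.half_norm_sq β)).congr_diff fun v => by
    rw [frobInner_add_left, frobInner_smul_left]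
    ring

end Calculus

variable {H d q n : ℕ}

/-! ### The augmented Lagrangian as a sum over layers -/

/-- The residual of the skip connection of the hidden layer `i`. -/
def Problem.skipRes (P : Problem H d q n) (z : Vars H d q n) (i : Fin H) :
    Matrix (Fin d) (Fin n) ℝ :=
  layer P.X z i.castSucc + (z.U i).map (P.σ i) - z.V i

/-- The residual of the linear constraint of the hidden layer `i`. -/
def Problem.linRes (P : Problem H d q n) (z : Vars H d q n) (i : Fin H) :
    Matrix (Fin d) (Fin n) ℝ :=
  z.W i * layer P.X z i.castSucc - z.U i

/-- The residual of the linear constraint of the output layer. -/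
def Problem.linResN (P : Problem H d q n) (z : Vars H d q n) : Matrix (Fin q) (Fin n) ℝ :=
  z.WN * layer P.X z (Fin.last H) - z.VN

/-- The part of the augmented Lagrangian that belongs to one layer, as a function of the input of
that layer. -/
def Problem.layerCost (P : Problem H d q n) (z : Vars H d q n) :
    Fin (H + 1) → Matrix (Fin d) (Fin n) ℝ → ℝ :=
  Fin.snoc (α := fun _ => Matrix (Fin d) (Fin n) ℝ → ℝ)
    (fun j A => P.mu / 2 * ‖A + (z.U j).map (P.σ j) - z.V j‖ ^ 2
      + penalty (P.β j) (z.Λ j) (z.W j * A - z.U j))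
    (fun A => penalty P.βN z.ΛN (z.WN * A - z.VN))

/-- The gradient of `layerCost`. -/
def Problem.layerGrad (P : Problem H d q n) (z : Vars H d q n) :
    Fin (H + 1) → Matrix (Fin d) (Fin n) ℝ → Matrix (Fin d) (Fin n) ℝ :=
  Fin.snoc (α := fun _ => Matrix (Fin d) (Fin n) ℝ → Matrix (Fin d) (Fin n) ℝ)
    (fun j A => P.mu • (A + (z.U j).map (P.σ j) - z.V j)
      + (z.W j)ᵀ * (z.Λ j + P.β j • (z.W j * A - z.U j)))
    (fun A => z.WNᵀ * (z.ΛN + P.βN • (z.WN * A - z.VN)))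

/-- The second order term of `layerCost`. -/
def Problem.layerQuad (P : Problem H d q n) (z : Vars H d q n) :
    Fin (H + 1) → Matrix (Fin d) (Fin n) ℝ → ℝ :=
  Fin.snoc (α := fun _ => Matrix (Fin d) (Fin n) ℝ → ℝ)
    (fun j D => P.mu / 2 * ‖D‖ ^ 2 + P.β j / 2 * ‖z.W j * D‖ ^ 2)
    (fun D => P.βN / 2 * ‖z.WN * D‖ ^ 2)

theorem Problem.layerCost_castSucc (P : Problem H d q n) (z : Vars H d q n) (j : Fin H)
    (A : Matrix (Fin d) (Fin n) ℝ) :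
    P.layerCost z j.castSucc A = P.mu / 2 * ‖A + (z.U j).map (P.σ j) - z.V j‖ ^ 2
      + penalty (P.β j) (z.Λ j) (z.W j * A - z.U j) := by
  simp [Problem.layerCost]

theorem Problem.layerCost_last (P : Problem H d q n) (z : Vars H d q n)
    (A : Matrix (Fin d) (Fin n) ℝ) :
    P.layerCost z (Fin.last H) A = penalty P.βN z.ΛN (z.WN * A - z.VN) := by
  simp [Problem.layerCost]

theorem Problem.layerGrad_castSucc (P : Problem H d q n) (z : Vars H d q n) (j : Fin H)
    (A : Matrix (Fin d) (Fin n) ℝ) :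
    P.layerGrad z j.castSucc A = P.mu • (A + (z.U j).map (P.σ j) - z.V j)
      + (z.W j)ᵀ * (z.Λ j + P.β j • (z.W j * A - z.U j)) := by
  simp [Problem.layerGrad]

theorem Problem.layerGrad_last (P : Problem H d q n) (z : Vars H d q n)
    (A : Matrix (Fin d) (Fin n) ℝ) :
    P.layerGrad z (Fin.last H) A = z.WNᵀ * (z.ΛN + P.βN • (z.WN * A - z.VN)) := by
  simp [Problem.layerGrad]

theorem Problem.layerQuad_castSucc (P : Problem H d q n) (z : Vars H d q n) (j : Fin H)
    (D : Matrix (Fin d) (Fin n) ℝ) :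
    P.layerQuad z j.castSucc D = P.mu / 2 * ‖D‖ ^ 2 + P.β j / 2 * ‖z.W j * D‖ ^ 2 := by
  simp [Problem.layerQuad]

theorem Problem.layerQuad_last (P : Problem H d q n) (z : Vars H d q n)
    (D : Matrix (Fin d) (Fin n) ℝ) :
    P.layerQuad z (Fin.last H) D = P.βN / 2 * ‖z.WN * D‖ ^ 2 := by
  simp [Problem.layerQuad]

theorem Problem.layerCost_add (P : Problem H d q n) (z : Vars H d q n) (j : Fin (H + 1))
    (A D : Matrix (Fin d) (Fin n) ℝ) :
    P.layerCost z j (A + D)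
      = P.layerCost z j A + frobInner (P.layerGrad z j A) D + P.layerQuad z j D := by
  refine Fin.lastCases ?_ (fun j => ?_) j
  · rw [P.layerCost_last, P.layerCost_last, P.layerGrad_last, P.layerQuad_last, Matrix.mul_add,
      add_sub_right_comm, penalty_add, frobInner_mul_right]
  · have h : A + D + (z.U j).map (P.σ j) - z.V j = A + (z.U j).map (P.σ j) - z.V j + D := by abel
    rw [P.layerCost_castSucc, P.layerCost_castSucc, P.layerGrad_castSucc, P.layerQuad_castSucc,
      Matrix.mul_add, add_sub_right_comm (z.W j * A), penalty_add, h, norm_sq_add,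
      frobInner_mul_right, frobInner_add_left, frobInner_smul_left]
    ring

theorem Problem.layerQuad_smul (P : Problem H d q n) (z : Vars H d q n) (j : Fin (H + 1))
    (t : ℝ) (D : Matrix (Fin d) (Fin n) ℝ) :
    P.layerQuad z j (t • D) = t ^ 2 * P.layerQuad z j D := by
  refine Fin.lastCases ?_ (fun j => ?_) j
  · rw [P.layerQuad_last, P.layerQuad_last, Matrix.mul_smul, norm_smul_sq]
    ring
  · rw [P.layerQuad_castSucc, P.layerQuad_castSucc, Matrix.mul_smul, norm_smul_sq, norm_smul_sq]
    ring

theorem layer_succ (X : Matrix (Fin d) (Fin n) ℝ) (z : Vars H d q n) (i : Fin H) :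
    layer X z i.succ = z.V i := by
  simp [layer]

theorem layer_zero (X : Matrix (Fin d) (Fin n) ℝ) (z : Vars H d q n) : layer X z 0 = X := by
  simp [layer]

/-- Each coupling term is assigned to the layer whose input it contains. Thus `V i` appears only as
the output in layer `i.castSucc` and as the input in layer `i.succ`. -/
theorem Problem.lagrangian_eq (P : Problem H d q n) (z : Vars H d q n) :
    P.lagrangian z = 1 / 2 * ‖z.VN - P.Y‖ ^ 2
      + (∑ i, P.lam / 2 * ‖z.W i‖ ^ 2 + P.lam / 2 * ‖z.WN‖ ^ 2)
      + ∑ j, P.layerCost z j (layer P.X z j) := by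
  rw [Fin.sum_univ_castSucc]
  simp only [P.layerCost_castSucc, P.layerCost_last, Finset.sum_add_distrib, penalty,
    ← Finset.mul_sum]
  rw [Problem.lagrangian, Finset.sum_add_distrib]
  ring

/-! ### The block gradients of the augmented Lagrangian -/

/-- The gradient of the augmented Lagrangian in the weights of a hidden layer. -/
def Problem.gradW (P : Problem H d q n) (z : Vars H d q n) (i : Fin H) :
    Matrix (Fin d) (Fin d) ℝ :=
  P.lam • z.W i + (z.Λ i + P.β i • P.linRes z i) * (layer P.X z i.castSucc)ᵀ

/-- The gradient of the augmented Lagrangian in the weights of the output layer. -/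
def Problem.gradWN (P : Problem H d q n) (z : Vars H d q n) : Matrix (Fin q) (Fin d) ℝ :=
  P.lam • z.WN + (z.ΛN + P.βN • P.linResN z) * (layer P.X z (Fin.last H))ᵀ

/-- The gradient of the augmented Lagrangian in the block `U`. -/
def Problem.gradU (P : Problem H d q n) (z : Vars H d q n) (i : Fin H) :
    Matrix (Fin d) (Fin n) ℝ :=
  P.mu • (P.skipRes z i ⊙ (z.U i).map (deriv (P.σ i))) - (z.Λ i + P.β i • P.linRes z i)

/-- The gradient of the augmented Lagrangian in the block `V`. -/
def Problem.gradV (P : Problem H d q n) (z : Vars H d q n) (i : Fin H) :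
    Matrix (Fin d) (Fin n) ℝ :=
  P.layerGrad z i.succ (z.V i) - P.mu • P.skipRes z i

/-- The gradient of the augmented Lagrangian in the output block. -/
def Problem.gradVN (P : Problem H d q n) (z : Vars H d q n) : Matrix (Fin q) (Fin n) ℝ :=
  (z.VN - P.Y) - (z.ΛN + P.βN • P.linResN z)

/-- An injective choice of coordinates only drops squares: a block of a direction is no longer than
the direction. -/
theorem norm_of_comp_le {ι : Type*} [Fintype ι] {a b : ℕ} (f : Fin a × Fin b → ι)
    (hf : Function.Injective f) (v : EuclideanSpace ℝ ι) :
    ‖(Matrix.of fun i j => v (f (i, j)) : Matrix (Fin a) (Fin b) ℝ)‖ ≤ ‖v‖ := by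
  classical
  refine le_of_sq_le_sq ?_ (norm_nonneg _)
  calc ‖(Matrix.of fun i j => v (f (i, j)) : Matrix (Fin a) (Fin b) ℝ)‖ ^ 2
      = ∑ p : Fin a × Fin b, ‖v (f p)‖ ^ 2 := by
        rw [norm_sq_eq_frobInner, frobInner_eq_sum, Fintype.sum_prod_type]
        simp [pow_two]
    _ = ∑ c ∈ Finset.univ.image f, ‖v c‖ ^ 2 := by
        rw [Finset.sum_image fun _ _ _ _ h => hf h]
    _ ≤ ∑ c, ‖v c‖ ^ 2 :=
        Finset.sum_le_sum_of_subset_of_nonneg (Finset.subset_univ _) fun _ _ _ => by positivity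
    _ = ‖v‖ ^ 2 := (EuclideanSpace.norm_sq_eq v).symm

theorem HasDiff.coord {ι : Type*} [Fintype ι] (c : ι) (z : EuclideanSpace ℝ ι) :
    HasDiff (fun w : EuclideanSpace ℝ ι => w c) (fun v => v c) z :=
  HasDiff.clm (EuclideanSpace.proj c)

/-- The network input `X` is constant, so a direction has `0` in its place. -/
theorem layer_ofVec_hasMDiff (X : Matrix (Fin d) (Fin n) ℝ)
    (z : EuclideanSpace ℝ (Coord H d q n)) (j : Fin (H + 1)) :
    HasMDiff (fun w => layer X (Vars.ofVec w) j) (fun v => layer 0 (Vars.ofVec v) j) z := by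
  refine Fin.cases ?_ (fun i => ?_) j
  · simp only [layer_zero]
    exact HasMDiff.const X
  · simp only [layer_succ]
    exact fun a b => HasDiff.coord (ι := Coord H d q n) (.inr (.inr (.inr (.inl (i, a, b))))) z

/-- The dependence through the layer input is kept as a separate term, so that it can later be
credited to the `V` block of the preceding layer. -/
theorem Problem.hasDiff_layerCost (P : Problem H d q n)
    (hσ : ∀ i, Differentiable ℝ (P.σ i)) (z : EuclideanSpace ℝ (Coord H d q n)) (j : Fin H) :
    HasDiff (fun w => P.layerCost (Vars.ofVec w) j.castSucc (layer P.X (Vars.ofVec w) j.castSucc))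
      (fun v => frobInner (P.layerGrad (Vars.ofVec z) j.castSucc
          (layer P.X (Vars.ofVec z) j.castSucc)) (layer 0 (Vars.ofVec v) j.castSucc)
        + (frobInner ((Vars.ofVec z).Λ j + P.β j • P.linRes (Vars.ofVec z) j)
            ((Vars.ofVec v).W j * layer P.X (Vars.ofVec z) j.castSucc)
          + frobInner (P.gradU (Vars.ofVec z) j) ((Vars.ofVec v).U j)
          - P.mu * frobInner (P.skipRes (Vars.ofVec z) j) ((Vars.ofVec v).V j)
          + frobInner (P.linRes (Vars.ofVec z) j) ((Vars.ofVec v).Λ j))) z := by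
  simp only [P.layerCost_castSucc]
  have hW : HasMDiff (fun w => (Vars.ofVec w).W j) (fun v => (Vars.ofVec v).W j) z :=
    fun a b => HasDiff.coord (ι := Coord H d q n) (.inl (j, a, b)) z
  have hU : HasMDiff (fun w => (Vars.ofVec w).U j) (fun v => (Vars.ofVec v).U j) z :=
    fun a b => HasDiff.coord (ι := Coord H d q n) (.inr (.inr (.inl (j, a, b)))) z
  have hV : HasMDiff (fun w => (Vars.ofVec w).V j) (fun v => (Vars.ofVec v).V j) z :=
    fun a b => HasDiff.coord (ι := Coord H d q n) (.inr (.inr (.inr (.inl (j, a, b))))) z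
  have hΛ : HasMDiff (fun w => (Vars.ofVec w).Λ j) (fun v => (Vars.ofVec v).Λ j) z :=
    fun a b => HasDiff.coord (ι := Coord H d q n)
      (.inr (.inr (.inr (.inr (.inr (.inl (j, a, b))))))) z
  have hl := layer_ofVec_hasMDiff P.X z j.castSucc
  refine ((((hl.add (hU.map (hσ j))).sub hV).half_norm_sq P.mu).add
    (hΛ.penalty (P.β j) ((hW.mul hl).sub hU))).congr_diff fun v => ?_
  rw [P.layerGrad_castSucc, Problem.gradU, Problem.skipRes, Problem.linRes]
  set l := layer P.X (Vars.ofVec z) j.castSucc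
  set z' := Vars.ofVec z
  set v' := Vars.ofVec v
  simp only [frobInner_add_left (P.mu • _), frobInner_sub_left (P.mu • _),
    frobInner_smul_left P.mu, frobInner_sub_right, frobInner_add_right, frobInner_hadamard_right]
  rw [frobInner_mul_right _ (z'.W j)]
  ring

theorem Problem.hasDiff_layerCost_last (P : Problem H d q n)
    (z : EuclideanSpace ℝ (Coord H d q n)) :
    HasDiff (fun w => P.layerCost (Vars.ofVec w) (Fin.last H)
        (layer P.X (Vars.ofVec w) (Fin.last H)))
      (fun v => frobInner (P.layerGrad (Vars.ofVec z) (Fin.last H)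
          (layer P.X (Vars.ofVec z) (Fin.last H))) (layer 0 (Vars.ofVec v) (Fin.last H))
        + (frobInner ((Vars.ofVec z).ΛN + P.βN • P.linResN (Vars.ofVec z))
            ((Vars.ofVec v).WN * layer P.X (Vars.ofVec z) (Fin.last H))
          - frobInner ((Vars.ofVec z).ΛN + P.βN • P.linResN (Vars.ofVec z)) (Vars.ofVec v).VN
          + frobInner (P.linResN (Vars.ofVec z)) (Vars.ofVec v).ΛN)) z := by
  simp only [P.layerCost_last]
  have hW : HasMDiff (fun w => (Vars.ofVec w).WN) (fun v => (Vars.ofVec v).WN) z :=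
    fun a b => HasDiff.coord (ι := Coord H d q n) (.inr (.inl (a, b))) z
  have hV : HasMDiff (fun w => (Vars.ofVec w).VN) (fun v => (Vars.ofVec v).VN) z :=
    fun a b => HasDiff.coord (ι := Coord H d q n) (.inr (.inr (.inr (.inr (.inl (a, b)))))) z
  have hΛ : HasMDiff (fun w => (Vars.ofVec w).ΛN) (fun v => (Vars.ofVec v).ΛN) z :=
    fun a b => HasDiff.coord (ι := Coord H d q n) (.inr (.inr (.inr (.inr (.inr (.inr (a, b))))))) z
  have hl := layer_ofVec_hasMDiff P.X z (Fin.last H)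
  refine (hΛ.penalty P.βN ((hW.mul hl).sub hV)).congr_diff fun v => ?_
  rw [P.layerGrad_last, Problem.linResN]
  simp only [frobInner_sub_right, frobInner_add_right]
  rw [frobInner_mul_right _ ((Vars.ofVec z).WN)]
  ring

theorem Problem.hasDiff_lagrangian (P : Problem H d q n)
    (hσ : ∀ i, Differentiable ℝ (P.σ i)) (z : EuclideanSpace ℝ (Coord H d q n)) :
    HasDiff (fun w => P.lagrangian (Vars.ofVec w))
      (fun v => (∑ i, (frobInner (P.gradW (Vars.ofVec z) i) ((Vars.ofVec v).W i)
          + frobInner (P.gradU (Vars.ofVec z) i) ((Vars.ofVec v).U i)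
          + frobInner (P.gradV (Vars.ofVec z) i) ((Vars.ofVec v).V i)
          + frobInner (P.linRes (Vars.ofVec z) i) ((Vars.ofVec v).Λ i)))
        + frobInner (P.gradWN (Vars.ofVec z)) (Vars.ofVec v).WN
        + frobInner (P.gradVN (Vars.ofVec z)) (Vars.ofVec v).VN
        + frobInner (P.linResN (Vars.ofVec z)) (Vars.ofVec v).ΛN) z := by
  simp only [P.lagrangian_eq]
  simp only [Fin.sum_univ_castSucc (fun j => P.layerCost _ j _)]
  have hW : ∀ i, HasMDiff (fun w => (Vars.ofVec w).W i) (fun v => (Vars.ofVec v).W i) z :=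
    fun i a b => HasDiff.coord (ι := Coord H d q n) (.inl (i, a, b)) z
  have hWN : HasMDiff (fun w => (Vars.ofVec w).WN) (fun v => (Vars.ofVec v).WN) z :=
    fun a b => HasDiff.coord (ι := Coord H d q n) (.inr (.inl (a, b))) z
  have hVN : HasMDiff (fun w => (Vars.ofVec w).VN) (fun v => (Vars.ofVec v).VN) z :=
    fun a b => HasDiff.coord (ι := Coord H d q n) (.inr (.inr (.inr (.inr (.inl (a, b)))))) z
  refine ((((hVN.sub (HasMDiff.const P.Y)).half_norm_sq 1).add
    ((HasDiff.sum Finset.univ fun i _ => (hW i).half_norm_sq P.lam).add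
      (hWN.half_norm_sq P.lam))).add
    ((HasDiff.sum Finset.univ fun j _ => P.hasDiff_layerCost hσ z j).add
      (P.hasDiff_layerCost_last z))).congr_diff fun v => ?_
  -- Input `0` has zero variation and input `i.succ` is `V i`. This reindexing yields the part of
  -- `gradV` that comes from the next layer.
  have key : ∑ j, frobInner (P.layerGrad (Vars.ofVec z) j (layer P.X (Vars.ofVec z) j))
        (layer 0 (Vars.ofVec v) j)
      = ∑ i, frobInner (P.layerGrad (Vars.ofVec z) i.succ ((Vars.ofVec z).V i))
        ((Vars.ofVec v).V i) := by
    rw [Fin.sum_univ_succ]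
    simp only [layer_zero, layer_succ, frobInner_zero_right, zero_add]
  rw [Fin.sum_univ_castSucc] at key
  simp only [Problem.gradW, Problem.gradV, Problem.gradWN, Problem.gradVN, frobInner_sub_left,
    frobInner_add_left (P.lam • _), frobInner_smul_left P.lam, frobInner_smul_left P.mu,
    ← frobInner_mul_right', Finset.sum_add_distrib, Finset.sum_sub_distrib, ← key, sub_zero]
  ring

/-- The gradient has the norm of the differential, which is bounded by Cauchy-Schwarz in each block.
-/
theorem Problem.gradNorm_le (P : Problem H d q n) (hσ : ∀ i, Differentiable ℝ (P.σ i))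
    (x : Vars H d q n) :
    P.gradNorm x ≤ (∑ i, (‖P.gradW x i‖ + ‖P.gradU x i‖ + ‖P.gradV x i‖ + ‖P.linRes x i‖))
      + ‖P.gradWN x‖ + ‖P.gradVN x‖ + ‖P.linResN x‖ := by
  obtain ⟨L, hL, hL'⟩ := P.hasDiff_lagrangian hσ x.toVec
  rw [Problem.gradNorm, gradient, LinearIsometryEquiv.norm_map, hL.fderiv]
  refine L.opNorm_le_bound (by positivity) fun v => ?_
  rw [hL', Vars.ofVec_toVec, Real.norm_eq_abs]
  have bd : ∀ {a b : ℕ} (A : Matrix (Fin a) (Fin b) ℝ) (f : Fin a × Fin b → Coord H d q n),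
      Function.Injective f → |frobInner A (Matrix.of fun i j => v (f (i, j)))| ≤ ‖A‖ * ‖v‖ :=
    fun A f hf => (abs_frobInner_le _ _).trans
      (mul_le_mul_of_nonneg_left (norm_of_comp_le f hf v) (norm_nonneg _))
  have hW : ∀ i, |frobInner (P.gradW x i) ((Vars.ofVec v).W i)| ≤ ‖P.gradW x i‖ * ‖v‖ :=
    fun i => bd _ (fun p => .inl (i, p.1, p.2)) fun p p' h => by simpa [Prod.ext_iff] using h
  have hU : ∀ i, |frobInner (P.gradU x i) ((Vars.ofVec v).U i)| ≤ ‖P.gradU x i‖ * ‖v‖ :=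
    fun i => bd _ (fun p => .inr (.inr (.inl (i, p.1, p.2))))
      fun p p' h => by simpa [Prod.ext_iff] using h
  have hV : ∀ i, |frobInner (P.gradV x i) ((Vars.ofVec v).V i)| ≤ ‖P.gradV x i‖ * ‖v‖ :=
    fun i => bd _ (fun p => .inr (.inr (.inr (.inl (i, p.1, p.2)))))
      fun p p' h => by simpa [Prod.ext_iff] using h
  have hΛ : ∀ i, |frobInner (P.linRes x i) ((Vars.ofVec v).Λ i)| ≤ ‖P.linRes x i‖ * ‖v‖ :=
    fun i => bd _ (fun p => .inr (.inr (.inr (.inr (.inr (.inl (i, p.1, p.2)))))))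
      fun p p' h => by simpa [Prod.ext_iff] using h
  have hWN : |frobInner (P.gradWN x) (Vars.ofVec v).WN| ≤ ‖P.gradWN x‖ * ‖v‖ :=
    bd _ (fun p => .inr (.inl p)) fun p p' h => by simpa using h
  have hVN : |frobInner (P.gradVN x) (Vars.ofVec v).VN| ≤ ‖P.gradVN x‖ * ‖v‖ :=
    bd _ (fun p => .inr (.inr (.inr (.inr (.inl p))))) fun p p' h => by simpa using h
  have hΛN : |frobInner (P.linResN x) (Vars.ofVec v).ΛN| ≤ ‖P.linResN x‖ * ‖v‖ :=
    bd _ (fun p => .inr (.inr (.inr (.inr (.inr (.inr p)))))) fun p p' h => by simpa using h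
  rw [add_mul, add_mul, add_mul, Finset.sum_mul]
  refine (abs_add_le _ _).trans (add_le_add ((abs_add_le _ _).trans (add_le_add
    ((abs_add_le _ _).trans (add_le_add ?_ hWN)) hVN)) hΛN)
  refine (Finset.abs_sum_le_sum_abs _ _).trans (Finset.sum_le_sum fun i _ => ?_)
  rw [add_mul, add_mul, add_mul]
  exact (abs_add_le _ _).trans (add_le_add ((abs_add_le _ _).trans (add_le_add
    ((abs_add_le _ _).trans (add_le_add (hW i) (hU i))) (hV i))) (hΛ i))

/-! ### The common form of the two algorithms -/

/-- The new weights together with the old values of all other blocks. -/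
def withWeights (x y : Vars H d q n) : Vars H d q n :=
  { x with W := y.W, WN := y.WN }

/-- One sweep, with every subproblem written in terms of the blocks that it involves. -/
structure Problem.LocalStep (P : Problem H d q n) (ω : Fin H → ℝ) (x y : Vars H d q n) :
    Prop where
  W : ∀ i (A : Matrix (Fin d) (Fin d) ℝ), P.lam / 2 * ‖y.W i‖ ^ 2
      + penalty (P.β i) (x.Λ i) (y.W i * layer P.X x i.castSucc - x.U i)
    ≤ P.lam / 2 * ‖A‖ ^ 2 + penalty (P.β i) (x.Λ i) (A * layer P.X x i.castSucc - x.U i)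
  WN : ∀ A : Matrix (Fin q) (Fin d) ℝ, P.lam / 2 * ‖y.WN‖ ^ 2
      + penalty P.βN x.ΛN (y.WN * layer P.X x (Fin.last H) - x.VN)
    ≤ P.lam / 2 * ‖A‖ ^ 2 + penalty P.βN x.ΛN (A * layer P.X x (Fin.last H) - x.VN)
  U : ∀ i A, P.mu / 2 * ‖layer P.X y i.castSucc + (y.U i).map (P.σ i) - x.V i‖ ^ 2
      + penalty (P.β i) (x.Λ i) (y.W i * layer P.X y i.castSucc - y.U i)
      + ω i / 2 * ‖y.U i - x.U i‖ ^ 2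
    ≤ P.mu / 2 * ‖layer P.X y i.castSucc + A.map (P.σ i) - x.V i‖ ^ 2
      + penalty (P.β i) (x.Λ i) (y.W i * layer P.X y i.castSucc - A)
      + ω i / 2 * ‖A - x.U i‖ ^ 2
  V : ∀ i A, P.mu / 2 * ‖layer P.X y i.castSucc + (y.U i).map (P.σ i) - y.V i‖ ^ 2
      + P.layerCost (withWeights x y) i.succ (y.V i)
    ≤ P.mu / 2 * ‖layer P.X y i.castSucc + (y.U i).map (P.σ i) - A‖ ^ 2
      + P.layerCost (withWeights x y) i.succ A
  VN : ∀ A, 1 / 2 * ‖y.VN - P.Y‖ ^ 2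
      + penalty P.βN x.ΛN (y.WN * layer P.X y (Fin.last H) - y.VN)
    ≤ 1 / 2 * ‖A - P.Y‖ ^ 2 + penalty P.βN x.ΛN (y.WN * layer P.X y (Fin.last H) - A)
  dual : P.DualStep x y

theorem penalty_sub_eq {a b : ℕ} {β : ℝ} (hβ : β ≠ 0) (Λ R A : Matrix (Fin a) (Fin b) ℝ) :
    penalty β Λ (R - A) = β / 2 * ‖A - R - (1 / β) • Λ‖ ^ 2 - ‖Λ‖ ^ 2 / (2 * β) := by
  rw [penalty_eq hβ, ← norm_neg (A - R - _)]
  congr 4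
  abel

/-- Each local objective differs from the Lagrangian terms by `‖Λ‖² / (2β)`, which does not depend
on the block being updated. -/
theorem Problem.ParallelStep.localStep {P : Problem H d q n} {ω : Fin H → ℝ}
    {x y : Vars H d q n} (hβ : ∀ i, P.β i ≠ 0) (hβN : P.βN ≠ 0) (h : P.ParallelStep ω x y) :
    P.LocalStep ω x y where
  W i A := by
    have := isMinOn_univ_iff.mp (h.W i) A
    rw [penalty_eq (hβ i), penalty_eq (hβ i)]
    linarith
  WN A := by
    have := isMinOn_univ_iff.mp h.WN A
    rw [penalty_eq hβN, penalty_eq hβN]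
    linarith
  U i A := by
    have := isMinOn_univ_iff.mp (h.U i) A
    rw [penalty_sub_eq (hβ i), penalty_sub_eq (hβ i)]
    linarith
  V i A := by
    rcases Nat.lt_or_ge (i + 1) H with hi | hi
    · obtain ⟨j, hj⟩ : ∃ j : Fin H, (i : ℕ) + 1 = j := ⟨⟨i + 1, hi⟩, rfl⟩
      have := isMinOn_univ_iff.mp (h.V i j hj) A
      rw [show i.succ = j.castSucc from Fin.ext hj, P.layerCost_castSucc, P.layerCost_castSucc,
        penalty_eq (hβ j), penalty_eq (hβ j)]
      simp only [withWeights]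
      linarith
    · have hi' : (i : ℕ) + 1 = H := by omega
      have := isMinOn_univ_iff.mp (h.V_last i hi') A
      have hs : ∀ B : Matrix (Fin d) (Fin n) ℝ,
          ‖layer P.X y i.castSucc + (y.U i).map (P.σ i) - B‖
            = ‖B - layer P.X y i.castSucc - (y.U i).map (P.σ i)‖ := fun B => by
        rw [norm_sub_rev, sub_sub]
      rw [show i.succ = Fin.last H from Fin.ext hi', P.layerCost_last, P.layerCost_last,
        penalty_eq hβN, penalty_eq hβN, hs, hs]
      simp only [withWeights]
      linarith
  VN A := by
    have := isMinOn_univ_iff.mp h.VN A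
    rw [penalty_sub_eq hβN, penalty_sub_eq hβN]
    linarith
  dual := h.dual

theorem sum_update_eq {ι M : Type*} [Fintype ι] [DecidableEq ι] (F : ι → M → ℝ) (g : ι → M) (i : ι)
    (A : M) : ∑ j, F j (Function.update g i A j)
      = F i A + ∑ j ∈ Finset.univ.erase i, F j (g j) := by
  rw [← Finset.add_sum_erase _ _ (Finset.mem_univ i), Function.update_self]
  congr 1
  exact Finset.sum_congr rfl fun j hj => by
    rw [Function.update_of_ne (Finset.ne_of_mem_erase hj)]

theorem layer_congr (X : Matrix (Fin d) (Fin n) ℝ) {z z' : Vars H d q n} (m : Fin (H + 1))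
    (h : ∀ j : Fin H, j.succ = m → z.V j = z'.V j) : layer X z m = layer X z' m := by
  induction m using Fin.cases with
  | zero => rw [layer_zero, layer_zero]
  | succ j => rw [layer_succ, layer_succ, h j rfl]

theorem layer_mk (X : Matrix (Fin d) (Fin n) ℝ) (x : Vars H d q n) (W WN U VN Λ ΛN) :
    layer X (⟨W, WN, U, x.V, VN, Λ, ΛN⟩ : Vars H d q n) = layer X x := rfl

theorem layer_congr_castSucc (X : Matrix (Fin d) (Fin n) ℝ) {z z' : Vars H d q n} (i : Fin H)
    (h : ∀ j < i, z.V j = z'.V j) : layer X z i.castSucc = layer X z' i.castSucc :=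
  layer_congr X _ fun j hj => h j <| by
    have := congrArg Fin.val hj
    simp only [Fin.val_succ, Fin.val_castSucc] at this
    rw [Fin.lt_def]
    omega

/-- All layer costs without the updated block cancel. The weights of different layers do not
interact while `V` is fixed, so their order is immaterial; when `V i` is updated, the next layer has
new weights but still its old `U`, `V` and `Λ`, exactly as in the parallel algorithm. -/
theorem Problem.SerialStep.localStep {P : Problem H d q n} {ω : Fin H → ℝ}
    {x y : Vars H d q n} (h : P.SerialStep ω x y) : P.LocalStep ω x y where
  W i A := by
    have := isMinOn_univ_iff.mp (h.W i) A
    simp only [P.lagrangian_eq, Fin.sum_univ_castSucc (fun j => P.layerCost _ j _),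
      P.layerCost_castSucc, P.layerCost_last, layer_mk, Finset.sum_add_distrib] at this
    rw [sum_update_eq (fun _ B => P.lam / 2 * ‖B‖ ^ 2),
      sum_update_eq (fun _ B => P.lam / 2 * ‖B‖ ^ 2),
      sum_update_eq (fun j B => penalty (P.β j) (x.Λ j) (B * layer P.X x j.castSucc - x.U j)),
      sum_update_eq (fun j B => penalty (P.β j) (x.Λ j) (B * layer P.X x j.castSucc - x.U j))]
      at this
    linarith
  WN A := by
    have := isMinOn_univ_iff.mp h.WN A
    simp only [P.lagrangian_eq, Fin.sum_univ_castSucc (fun j => P.layerCost _ j _),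
      P.layerCost_castSucc, P.layerCost_last, layer_mk] at this
    linarith
  U i A := by
    have := isMinOn_univ_iff.mp (h.U i) A
    simp only [P.lagrangian_eq, Fin.sum_univ_castSucc (fun j => P.layerCost _ j _),
      P.layerCost_castSucc, P.layerCost_last] at this
    set V' : Fin H → Matrix (Fin d) (Fin n) ℝ := fun j => if j < i then y.V j else x.V j with hV'
    set U' : Fin H → Matrix (Fin d) (Fin n) ℝ := fun j => if j < i then y.U j else x.U j
    set l := layer P.X { x with V := V' }
    have hl : l i.castSucc = layer P.X y i.castSucc :=
      layer_congr_castSucc _ _ fun j hj => by simp [hV', hj]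
    have hsum := sum_update_eq (fun j B => P.mu / 2 * ‖l j.castSucc + B.map (P.σ j) - V' j‖ ^ 2
      + penalty (P.β j) (x.Λ j) (y.W j * l j.castSucc - B)) U' i
    have h1 := hsum A
    have h2 := hsum (y.U i)
    simp only [hl, show V' i = x.V i by simp [hV']] at h1 h2
    -- `layer` reads only the field `V`, so the inputs of the full record are those given by `l`, by
    -- definition.
    change _ + (∑ j, (P.mu / 2 * ‖l j.castSucc + (Function.update U' i (y.U i) j).map (P.σ j)
        - V' j‖ ^ 2 + penalty (P.β j) (x.Λ j) (y.W j * l j.castSucc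
          - Function.update U' i (y.U i) j))
        + penalty P.βN x.ΛN (y.WN * l (Fin.last H) - x.VN)) + _
      ≤ _ + (∑ j, (P.mu / 2 * ‖l j.castSucc + (Function.update U' i A j).map (P.σ j)
        - V' j‖ ^ 2 + penalty (P.β j) (x.Λ j) (y.W j * l j.castSucc
          - Function.update U' i A j))
        + penalty P.βN x.ΛN (y.WN * l (Fin.last H) - x.VN)) + _ at this
    rw [h1, h2] at this
    linarith
  V i A := by
    have := isMinOn_univ_iff.mp (h.V i) A
    set V' : Fin H → Matrix (Fin d) (Fin n) ℝ := fun j => if j < i then y.V j else x.V j with hV'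
    set z : Matrix (Fin d) (Fin n) ℝ → Vars H d q n := fun B =>
      { x with
        WN := y.WN
        W := y.W
        U := fun j => if j ≤ i then y.U j else x.U j
        V := Function.update V' i B } with hz
    have hlow : ∀ B, layer P.X (z B) i.castSucc = layer P.X y i.castSucc := fun B =>
      layer_congr_castSucc _ _ fun j hj => by simp [hz, hV', hj.ne, hj]
    -- Only the layer that outputs `V i` and the layer that receives it notice the choice of `V i`.
    have hrest : ∀ j, j ≠ i.castSucc ∧ j ≠ i.succ → P.layerCost (z (y.V i)) j
          (layer P.X (z (y.V i)) j) - P.layerCost (z A) j (layer P.X (z A) j) = 0 := by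
      intro j hj
      have hl : layer P.X (z (y.V i)) j = layer P.X (z A) j := layer_congr _ _ fun m hm => by
        have : m ≠ i := fun h => hj.2 (by rw [← hm, h])
        simp [hz, this]
      rw [hl, sub_eq_zero]
      induction j using Fin.lastCases with
      | last => rw [P.layerCost_last, P.layerCost_last]
      | cast j =>
        have : j ≠ i := fun h => hj.1 (by rw [h])
        simp [P.layerCost_castSucc, hz, this]
    have hi : ∀ B, P.layerCost (z B) i.castSucc (layer P.X (z B) i.castSucc)
        = P.mu / 2 * ‖layer P.X y i.castSucc + (y.U i).map (P.σ i) - B‖ ^ 2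
          + penalty (P.β i) (x.Λ i) (y.W i * layer P.X y i.castSucc - y.U i) := fun B => by
      rw [P.layerCost_castSucc, hlow]
      simp [hz]
    have hs : ∀ B, P.layerCost (z B) i.succ (layer P.X (z B) i.succ)
        = P.layerCost (withWeights x y) i.succ B := fun B => by
      rw [layer_succ, show (z B).V i = B by simp [hz]]
      rcases Nat.lt_or_ge (i + 1) H with hi | hi
      · obtain ⟨j, hj⟩ : ∃ j : Fin H, (i : ℕ) + 1 = j := ⟨⟨i + 1, hi⟩, rfl⟩
        have hij : i < j := by rw [Fin.lt_def]; omega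
        rw [show i.succ = j.castSucc from Fin.ext hj, P.layerCost_castSucc, P.layerCost_castSucc]
        simp [hz, hV', withWeights, hij.ne', hij.not_ge, hij.not_gt]
      · rw [show i.succ = Fin.last H from Fin.ext (by simp; omega), P.layerCost_last,
          P.layerCost_last]
        rfl
    have hne : i.castSucc ≠ i.succ := by simp [Fin.ext_iff]
    have hsum := Fintype.sum_eq_add i.castSucc i.succ hne hrest
    rw [Finset.sum_sub_distrib, hi, hi, hs, hs] at hsum
    change P.lagrangian (z (y.V i)) ≤ P.lagrangian (z A) at this
    rw [P.lagrangian_eq, P.lagrangian_eq] at this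
    linarith
  VN A := by
    have := isMinOn_univ_iff.mp h.VN A
    simp only [P.lagrangian_eq, Fin.sum_univ_castSucc (fun j => P.layerCost _ j _),
      P.layerCost_castSucc, P.layerCost_last, layer_mk] at this
    linarith
  dual := h.dual

/-! ### Optimality conditions and descent of one sweep -/

theorem norm_smul_add_sq_remainder {a b c : ℕ} (r s t : ℝ) (D : Matrix (Fin a) (Fin b) ℝ)
    (V : Matrix (Fin b) (Fin c) ℝ) :
    r / 2 * ‖t • D‖ ^ 2 + s / 2 * ‖(t • D) * V‖ ^ 2
      = t ^ 2 * (r / 2 * ‖D‖ ^ 2 + s / 2 * ‖D * V‖ ^ 2) := by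
  rw [Matrix.smul_mul, norm_smul_sq, norm_smul_sq]
  ring

theorem weight_cost_add {a b c : ℕ} (r β : ℝ) (Λ U : Matrix (Fin a) (Fin c) ℝ)
    (V : Matrix (Fin b) (Fin c) ℝ) (A D : Matrix (Fin a) (Fin b) ℝ) :
    r / 2 * ‖A + D‖ ^ 2 + penalty β Λ ((A + D) * V - U)
      = r / 2 * ‖A‖ ^ 2 + penalty β Λ (A * V - U)
        + frobInner (r • A + (Λ + β • (A * V - U)) * Vᵀ) D
        + (r / 2 * ‖D‖ ^ 2 + β / 2 * ‖D * V‖ ^ 2) := by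
  rw [Matrix.add_mul, add_sub_right_comm, penalty_add, norm_sq_add, frobInner_mul_right',
    frobInner_add_left (r • A), frobInner_smul_left r]
  ring

theorem weight_min_eq {a b c : ℕ} {r β : ℝ} {Λ U : Matrix (Fin a) (Fin c) ℝ}
    {V : Matrix (Fin b) (Fin c) ℝ} {y : Matrix (Fin a) (Fin b) ℝ}
    (h : ∀ A : Matrix (Fin a) (Fin b) ℝ, r / 2 * ‖y‖ ^ 2 + penalty β Λ (y * V - U)
      ≤ r / 2 * ‖A‖ ^ 2 + penalty β Λ (A * V - U)) :
    r • y + (Λ + β • (y * V - U)) * Vᵀ = 0 :=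
  eq_zero_of_quadratic_min (F := fun A => r / 2 * ‖A‖ ^ 2 + penalty β Λ (A * V - U))
    (Q := fun D => r / 2 * ‖D‖ ^ 2 + β / 2 * ‖D * V‖ ^ 2) (weight_cost_add r β Λ U V y)
    (fun t D => norm_smul_add_sq_remainder r β t D V) h

/-- Expanding exactly about the minimizer kills the linear term; of the quadratic remainder only the
ridge part is kept. -/
theorem weight_min_descent {a b c : ℕ} {r β : ℝ} (hβ : 0 ≤ β) {Λ U : Matrix (Fin a) (Fin c) ℝ}
    {V : Matrix (Fin b) (Fin c) ℝ} {y : Matrix (Fin a) (Fin b) ℝ}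
    (h : ∀ A : Matrix (Fin a) (Fin b) ℝ, r / 2 * ‖y‖ ^ 2 + penalty β Λ (y * V - U)
      ≤ r / 2 * ‖A‖ ^ 2 + penalty β Λ (A * V - U)) (x : Matrix (Fin a) (Fin b) ℝ) :
    r / 2 * ‖y‖ ^ 2 + penalty β Λ (y * V - U) + r / 2 * ‖y - x‖ ^ 2
      ≤ r / 2 * ‖x‖ ^ 2 + penalty β Λ (x * V - U) := by
  have h1 := weight_cost_add r β Λ U V y (x - y)
  rw [weight_min_eq h, frobInner_zero_left, add_sub_cancel, norm_sub_rev] at h1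
  have : 0 ≤ β / 2 * ‖(x - y) * V‖ ^ 2 := by positivity
  linarith

theorem output_cost_add {a b : ℕ} (β : ℝ) (Λ R Y A D : Matrix (Fin a) (Fin b) ℝ) :
    1 / 2 * ‖A + D - Y‖ ^ 2 + penalty β Λ (R - (A + D))
      = 1 / 2 * ‖A - Y‖ ^ 2 + penalty β Λ (R - A)
        + frobInner (A - Y - (Λ + β • (R - A))) D + (1 + β) / 2 * ‖D‖ ^ 2 := by
  rw [add_sub_right_comm, norm_sq_add, ← sub_sub, sub_eq_add_neg (R - A) D, penalty_add, norm_neg,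
    frobInner_neg_right, frobInner_sub_left (A - Y)]
  ring

/-- The multiplier moves by `β • R`, and `⟨β • R, R⟩ = ‖β • R‖² / β`. This is the only increase in a
sweep. -/
theorem penalty_dual_update {a b : ℕ} {β : ℝ} {Λ Λ' R : Matrix (Fin a) (Fin b) ℝ}
    (h : Λ' = Λ + β • R) : penalty β Λ' R = penalty β Λ R + 1 / β * ‖Λ' - Λ‖ ^ 2 := by
  rw [h, add_sub_cancel_left, norm_smul_sq, penalty, penalty, frobInner_add_left,
    frobInner_smul_left, norm_sq_eq_frobInner]
  field_simp
  ring

/-- The problem in `U` is not quadratic, so its stationarity is obtained by differentiating along a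
line. -/
theorem HasMDiff.line {a b : ℕ} (A D : Matrix (Fin a) (Fin b) ℝ) :
    HasMDiff (fun t : ℝ => A + t • D) (fun s => s • D) 0 := fun i j =>
  ((HasDiff.const (A i j)).add (HasDiff.clm (ContinuousLinearMap.id ℝ ℝ)
    |>.mul (HasDiff.const (D i j)))).congr_diff fun v => by simp

namespace Problem.LocalStep

variable {P : Problem H d q n} {ω : Fin H → ℝ} {x y : Vars H d q n}

/-- The multiplier of a hidden layer, from the first order condition in `U`. -/
theorem dual_eq (hσ : ∀ i, Differentiable ℝ (P.σ i)) (h : P.LocalStep ω x y) (i : Fin H) :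
    y.Λ i = P.mu • ((layer P.X y i.castSucc + (y.U i).map (P.σ i) - x.V i)
        ⊙ (y.U i).map (deriv (P.σ i))) + ω i • (y.U i - x.U i) := by
  set l := layer P.X y i.castSucc
  -- `G` is the gradient of the `U` problem at its minimizer, with the dual update inserted. The
  -- derivative in the direction `G` is `‖G‖²`.
  set G := P.mu • ((l + (y.U i).map (P.σ i) - x.V i) ⊙ (y.U i).map (deriv (P.σ i)))
    + ω i • (y.U i - x.U i) - y.Λ i with hG
  have hU := HasMDiff.line (y.U i) G
  have hd := (((((HasMDiff.const l).add (hU.map (hσ i))).sub (HasMDiff.const (x.V i))).half_norm_sq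
    P.mu).add ((HasMDiff.const (x.Λ i)).penalty (P.β i)
      ((HasMDiff.const (y.W i * l)).sub hU))).add
      ((hU.sub (HasMDiff.const (x.U i))).half_norm_sq (ω i))
  have h0 := hd.eq_zero_of_min (fun t => by simpa using h.U i (y.U i + t • G)) 1
  simp only [zero_smul, add_zero, one_smul, zero_add, sub_zero, frobInner_hadamard_right,
    frobInner_zero_right, zero_sub, frobInner_neg_right] at h0
  rw [← h.dual.Λ i, ← frobInner_smul_left, ← frobInner_smul_left, ← sub_eq_add_neg,
    ← frobInner_sub_left, ← frobInner_add_left, sub_add_eq_add_sub, ← hG,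
    ← norm_sq_eq_frobInner] at h0
  have : G = 0 := by simpa using h0
  exact (sub_eq_zero.mp this).symm

theorem W_eq (h : P.LocalStep ω x y) (i : Fin H) :
    P.lam • y.W i + (x.Λ i + P.β i • (y.W i * layer P.X x i.castSucc - x.U i))
      * (layer P.X x i.castSucc)ᵀ = 0 :=
  weight_min_eq (h.W i)

theorem WN_eq (h : P.LocalStep ω x y) :
    P.lam • y.WN + (x.ΛN + P.βN • (y.WN * layer P.X x (Fin.last H) - x.VN))
      * (layer P.X x (Fin.last H))ᵀ = 0 :=
  weight_min_eq h.WN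

theorem output_eq (h : P.LocalStep ω x y) :
    y.VN - P.Y - (x.ΛN + P.βN • (y.WN * layer P.X y (Fin.last H) - y.VN)) = 0 :=
  eq_zero_of_quadratic_min
    (F := fun A => 1 / 2 * ‖A - P.Y‖ ^ 2
      + penalty P.βN x.ΛN (y.WN * layer P.X y (Fin.last H) - A))
    (Q := fun D => (1 + P.βN) / 2 * ‖D‖ ^ 2)
    (output_cost_add P.βN x.ΛN _ P.Y y.VN) (fun t D => by simp only [norm_smul_sq]; ring) h.VN

/-- The dual update makes the output multiplier the gradient of the loss, so its increment is that
of `VN`. -/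
theorem dualN_eq (h : P.LocalStep ω x y) : y.ΛN = y.VN - P.Y := by
  rw [h.dual.ΛN]
  exact (sub_eq_zero.mp h.output_eq).symm

theorem V_cost_add (P : Problem H d q n) (z : Vars H d q n) (j : Fin (H + 1))
    (S A D : Matrix (Fin d) (Fin n) ℝ) :
    P.mu / 2 * ‖S - (A + D)‖ ^ 2 + P.layerCost z j (A + D)
      = P.mu / 2 * ‖S - A‖ ^ 2 + P.layerCost z j A
        + frobInner (P.layerGrad z j A - P.mu • (S - A)) D
        + (P.mu / 2 * ‖D‖ ^ 2 + P.layerQuad z j D) := by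
  rw [← sub_sub, sub_eq_add_neg (S - A) D, norm_sq_add, norm_neg, frobInner_neg_right,
    P.layerCost_add, frobInner_sub_left (P.layerGrad z j A), frobInner_smul_left]
  ring

theorem V_eq (h : P.LocalStep ω x y) (i : Fin H) :
    P.layerGrad (withWeights x y) i.succ (y.V i) - P.mu • P.skipRes y i = 0 :=
  eq_zero_of_quadratic_min
    (F := fun A => P.mu / 2 * ‖layer P.X y i.castSucc + (y.U i).map (P.σ i) - A‖ ^ 2
      + P.layerCost (withWeights x y) i.succ A)
    (Q := fun D => P.mu / 2 * ‖D‖ ^ 2 + P.layerQuad (withWeights x y) i.succ D)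
    (V_cost_add P (withWeights x y) i.succ _ (y.V i))
    (fun t D => by simp only [norm_smul_sq, P.layerQuad_smul]; ring) (h.V i)

theorem V_descent (hmu : 0 ≤ P.mu) (hβ : ∀ i, 0 ≤ P.β i) (hβN : 0 ≤ P.βN)
    (h : P.LocalStep ω x y) (i : Fin H) :
    P.mu / 2 * ‖layer P.X y i.castSucc + (y.U i).map (P.σ i) - y.V i‖ ^ 2
        + P.layerCost (withWeights x y) i.succ (y.V i) + P.mu / 2 * ‖y.V i - x.V i‖ ^ 2
      ≤ P.mu / 2 * ‖layer P.X y i.castSucc + (y.U i).map (P.σ i) - x.V i‖ ^ 2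
        + P.layerCost (withWeights x y) i.succ (x.V i) := by
  have h1 := V_cost_add P (withWeights x y) i.succ
    (layer P.X y i.castSucc + (y.U i).map (P.σ i)) (y.V i) (x.V i - y.V i)
  have h2 := h.V_eq i
  rw [Problem.skipRes] at h2
  rw [h2, frobInner_zero_left, add_sub_cancel, norm_sub_rev (x.V i)] at h1
  have h3 : 0 ≤ P.layerQuad (withWeights x y) i.succ (x.V i - y.V i) := by
    generalize i.succ = j
    induction j using Fin.lastCases with
    | last =>
      rw [P.layerQuad_last]
      positivity
    | cast j =>
      rw [P.layerQuad_castSucc]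
      have := hβ j
      positivity
  linarith

theorem output_descent (h : P.LocalStep ω x y) :
    1 / 2 * ‖y.VN - P.Y‖ ^ 2 + penalty P.βN x.ΛN (y.WN * layer P.X y (Fin.last H) - y.VN)
        + (1 + P.βN) / 2 * ‖y.VN - x.VN‖ ^ 2
      ≤ 1 / 2 * ‖x.VN - P.Y‖ ^ 2
        + penalty P.βN x.ΛN (y.WN * layer P.X y (Fin.last H) - x.VN) := by
  have h1 := output_cost_add P.βN x.ΛN (y.WN * layer P.X y (Fin.last H)) P.Y y.VN (x.VN - y.VN)
  rw [h.output_eq, frobInner_zero_left, add_sub_cancel, norm_sub_rev x.VN y.VN] at h1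
  linarith

/-- The change of the augmented Lagrangian in one sweep. -/
theorem descent (hmu : 0 ≤ P.mu) (hβ : ∀ i, 0 < P.β i) (hβN : 0 < P.βN)
    (h : P.LocalStep ω x y) :
    P.lagrangian y + (∑ i, P.lam / 2 * ‖y.W i - x.W i‖ ^ 2) + P.lam / 2 * ‖y.WN - x.WN‖ ^ 2
        + (∑ i, ω i / 2 * ‖y.U i - x.U i‖ ^ 2) + (∑ i, P.mu / 2 * ‖y.V i - x.V i‖ ^ 2)
        + (1 + P.βN) / 2 * ‖y.VN - x.VN‖ ^ 2
      ≤ P.lagrangian x + (∑ i, 1 / P.β i * ‖y.Λ i - x.Λ i‖ ^ 2)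
        + 1 / P.βN * ‖y.ΛN - x.ΛN‖ ^ 2 := by
  set z := withWeights x y with hz
  have hW := Finset.sum_le_sum fun i (_ : i ∈ Finset.univ) =>
    weight_min_descent (hβ i).le (h.W i) (x.W i)
  have hWN := weight_min_descent hβN.le h.WN x.WN
  have hVN := h.output_descent
  -- The `U` and `V` updates of one layer combined. On the right its input is already new and the
  -- next layer's input is old; on the left its own blocks and the next layer's input are new.
  have hUV : ∀ i : Fin H, P.mu / 2 * ‖layer P.X y i.castSucc + (y.U i).map (P.σ i) - y.V i‖ ^ 2
      + penalty (P.β i) (x.Λ i) (y.W i * layer P.X y i.castSucc - y.U i)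
      + P.layerCost z i.succ (layer P.X y i.succ)
      + ω i / 2 * ‖y.U i - x.U i‖ ^ 2 + P.mu / 2 * ‖y.V i - x.V i‖ ^ 2
      ≤ P.layerCost z i.castSucc (layer P.X y i.castSucc)
        + P.layerCost z i.succ (layer P.X x i.succ) := fun i => by
    have h1 := h.U i (x.U i)
    have h2 := h.V_descent hmu (fun i => (hβ i).le) hβN.le i
    rw [sub_self, norm_zero] at h1
    rw [layer_succ, layer_succ, P.layerCost_castSucc]
    simp only [hz, withWeights] at h2 ⊢
    linarith
  have hsum := Finset.sum_le_sum fun i (_ : i ∈ Finset.univ) => hUV i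
  -- Summed over the layers, the costs at new inputs telescope: only the output layer and layer `0`
  -- remain, and the input of layer `0` is `X` before and after.
  have hy1 := Fin.sum_univ_succ fun j => P.layerCost z j (layer P.X y j)
  have hy2 := Fin.sum_univ_castSucc fun j => P.layerCost z j (layer P.X y j)
  have hx1 := Fin.sum_univ_succ fun j => P.layerCost z j (layer P.X x j)
  have hx2 := Fin.sum_univ_castSucc fun j => P.layerCost z j (layer P.X x j)
  have hD := Finset.sum_congr rfl fun i (_ : i ∈ Finset.univ) =>
    penalty_dual_update (h.dual.Λ i)
  have hDN := penalty_dual_update h.dual.ΛN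
  rw [layer_zero] at hy1 hx1
  rw [P.layerCost_last] at hy2 hx2
  simp only [P.layerCost_castSucc z _ (layer P.X x _), Finset.sum_add_distrib] at hx2
  simp only [Finset.sum_add_distrib] at hW hsum hD
  rw [P.lagrangian_eq, P.lagrangian_eq, Fin.sum_univ_castSucc, Fin.sum_univ_castSucc,
    P.layerCost_last, P.layerCost_last]
  simp only [P.layerCost_castSucc _ _ (layer P.X _ _), Finset.sum_add_distrib]
  simp only [hz, withWeights] at *
  linarith

end Problem.LocalStep

/-! ### Estimates of the multipliers -/

section Activation

variable {P : Problem H d q n} {ψ₀ ψ₁ ψ₂ : ℝ}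

theorem Problem.ActivationAssumption.differentiable (hσ : P.ActivationAssumption ψ₀ ψ₁ ψ₂)
    (i : Fin H) : Differentiable ℝ (P.σ i) := fun t =>
  (hσ.analytic i t (Set.mem_univ t)).differentiableAt

theorem Problem.ActivationAssumption.abs_sub_le (hσ : P.ActivationAssumption ψ₀ ψ₁ ψ₂)
    (i : Fin H) (s t : ℝ) : |P.σ i t - P.σ i s| ≤ ψ₁ * |t - s| :=
  convex_univ.norm_image_sub_le_of_norm_deriv_le (fun r _ => hσ.differentiable i r)
    (fun r _ => hσ.bound₁ i r) (Set.mem_univ s) (Set.mem_univ t)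

theorem Problem.ActivationAssumption.abs_deriv_sub_le (hσ : P.ActivationAssumption ψ₀ ψ₁ ψ₂)
    (i : Fin H) (s t : ℝ) : |deriv (P.σ i) t - deriv (P.σ i) s| ≤ ψ₂ * |t - s| :=
  convex_univ.norm_image_sub_le_of_norm_deriv_le
    (fun r _ => ((hσ.analytic i).deriv r (Set.mem_univ r)).differentiableAt)
    (fun r _ => hσ.bound₂ i r) (Set.mem_univ s) (Set.mem_univ t)

theorem Problem.ActivationAssumption.norm_hadamard_deriv_le
    (hσ : P.ActivationAssumption ψ₀ ψ₁ ψ₂) (i : Fin H) (A U : Matrix (Fin d) (Fin n) ℝ) :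
    ‖A ⊙ U.map (deriv (P.σ i))‖ ≤ ψ₁ * ‖A‖ := by
  rw [Matrix.hadamard_comm]
  exact norm_hadamard_le_of_entry_le hσ.pos₁.le (fun a b => hσ.bound₁ i _) A

theorem Problem.ActivationAssumption.norm_map_le
    (hσ : P.ActivationAssumption ψ₀ ψ₁ ψ₂) (i : Fin H) (U : Matrix (Fin d) (Fin n) ℝ) :
    ‖U.map (P.σ i)‖ ≤ ψ₀ * ‖ones d n‖ :=
  norm_le_mul_norm_ones hσ.pos₀.le fun _ _ => hσ.bound₀ i _

theorem Problem.ActivationAssumption.norm_map_sub_le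
    (hσ : P.ActivationAssumption ψ₀ ψ₁ ψ₂) (i : Fin H) (U U' : Matrix (Fin d) (Fin n) ℝ) :
    ‖U.map (P.σ i) - U'.map (P.σ i)‖ ≤ ψ₁ * ‖U - U'‖ :=
  norm_le_of_entry_le hσ.pos₁.le fun _ _ => hσ.abs_sub_le i _ _

/-- Changes of `l` and `v` are multiplied by `σ'`, hence cost `ψ₁`. For fixed `l` and `v`, each
entry of the product is Lipschitz in `U` with constant `(a + ψ₀ + b) ψ₂ + ψ₁²`. Arguing entrywise
keeps dimensions out of the constant, which becomes `modulus` after multiplication by `mu`. -/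
theorem Problem.ActivationAssumption.norm_skip_hadamard_sub_le
    (hσ : P.ActivationAssumption ψ₀ ψ₁ ψ₂) (i : Fin H)
    (l l' U U' v v' : Matrix (Fin d) (Fin n) ℝ) {a b : ℝ} (hl : ‖l‖ ≤ a) (hv : ‖v‖ ≤ b) :
    ‖(l + U.map (P.σ i) - v) ⊙ U.map (deriv (P.σ i))
        - (l' + U'.map (P.σ i) - v') ⊙ U'.map (deriv (P.σ i))‖
      ≤ ψ₁ * ‖l - l'‖ + ψ₁ * ‖v - v'‖ + (ψ₀ * ψ₂ + ψ₁ ^ 2 + b * ψ₂ + a * ψ₂) * ‖U - U'‖ := by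
  have ha : 0 ≤ a := (norm_nonneg _).trans hl
  have hb : 0 ≤ b := (norm_nonneg _).trans hv
  have h0 := hσ.pos₀
  have h1 := hσ.pos₁
  have h2 := hσ.pos₂
  set R : Matrix (Fin d) (Fin n) ℝ :=
    (l + U.map (P.σ i) - v) ⊙ (U.map (deriv (P.σ i)) - U'.map (deriv (P.σ i)))
      + (U.map (P.σ i) - U'.map (P.σ i)) ⊙ U'.map (deriv (P.σ i)) with hR
  have hRle : ‖R‖ ≤ (ψ₀ * ψ₂ + ψ₁ ^ 2 + b * ψ₂ + a * ψ₂) * ‖U - U'‖ := by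
    refine norm_le_of_entry_le (by positivity) fun p r => ?_
    simp only [hR, Matrix.add_apply, Matrix.sub_apply, Matrix.hadamard_apply, Matrix.map_apply]
    have e1 : |l p r + P.σ i (U p r) - v p r| ≤ a + ψ₀ + b := by
      refine (abs_sub _ _).trans (add_le_add ((abs_add_le _ _).trans (add_le_add ?_ ?_)) ?_)
      · exact (abs_entry_le_norm l p r).trans hl
      · exact hσ.bound₀ i _
      · exact (abs_entry_le_norm v p r).trans hv
    calc _ ≤ |l p r + P.σ i (U p r) - v p r|
            * |deriv (P.σ i) (U p r) - deriv (P.σ i) (U' p r)|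
          + |P.σ i (U p r) - P.σ i (U' p r)| * |deriv (P.σ i) (U' p r)| := by
          rw [← abs_mul, ← abs_mul]
          exact abs_add_le _ _
      _ ≤ (a + ψ₀ + b) * (ψ₂ * |U p r - U' p r|) + (ψ₁ * |U p r - U' p r|) * ψ₁ := by
          gcongr
          · exact hσ.abs_deriv_sub_le i _ _
          · exact hσ.abs_sub_le i _ _
          · exact hσ.bound₁ i _
      _ = _ := by ring
  have hsplit : (l + U.map (P.σ i) - v) ⊙ U.map (deriv (P.σ i))
        - (l' + U'.map (P.σ i) - v') ⊙ U'.map (deriv (P.σ i))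
      = (l - l') ⊙ U'.map (deriv (P.σ i)) - (v - v') ⊙ U'.map (deriv (P.σ i)) + R := by
    ext p r
    simp only [hR, Matrix.add_apply, Matrix.sub_apply, Matrix.hadamard_apply]
    ring
  rw [hsplit]
  exact (norm_add_le _ _).trans (add_le_add ((norm_sub_le _ _).trans
    (add_le_add (hσ.norm_hadamard_deriv_le i _ _) (hσ.norm_hadamard_deriv_le i _ _))) hRle)

theorem norm_layer_le {X : Matrix (Fin d) (Fin n) ℝ} {Vmax : Fin (H + 1) → ℝ}
    (hX : ‖X‖ ≤ Vmax 0) {z : Vars H d q n} (hz : ∀ i : Fin H, ‖z.V i‖ ≤ Vmax i.succ)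
    (j : Fin (H + 1)) : ‖layer X z j‖ ≤ Vmax j := by
  induction j using Fin.cases with
  | zero => rwa [layer_zero]
  | succ i => rw [layer_succ]; exact hz i

/-- A bound for the part of the multiplier of a hidden layer that does not involve the proximal
term. -/
def Problem.dualBound (P : Problem H d q n) (ψ₀ ψ₁ : ℝ) (Vmax : Fin (H + 1) → ℝ) (i : Fin H) : ℝ :=
  P.mu * (ψ₁ * (Vmax i.castSucc + ψ₀ * ‖ones d n‖ + Vmax i.succ))

theorem Problem.LocalStep.norm_dual_le {ω : Fin H → ℝ} {x y : Vars H d q n}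
    {Vmax : Fin (H + 1) → ℝ} (hσ : P.ActivationAssumption ψ₀ ψ₁ ψ₂) (hmu : 0 ≤ P.mu)
    (hX : ‖P.X‖ ≤ Vmax 0) (hVx : ∀ i : Fin H, ‖x.V i‖ ≤ Vmax i.succ)
    (hVy : ∀ i : Fin H, ‖y.V i‖ ≤ Vmax i.succ) (h : P.LocalStep ω x y) (i : Fin H)
    (hω : 0 ≤ ω i) :
    ‖y.Λ i‖ ≤ P.dualBound ψ₀ ψ₁ Vmax i + ω i * ‖y.U i - x.U i‖ := by
  rw [h.dual_eq hσ.differentiable i, Problem.dualBound]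
  refine (norm_add_le _ _).trans (add_le_add ?_ ?_)
  · rw [norm_smul, Real.norm_of_nonneg hmu]
    refine mul_le_mul_of_nonneg_left ((hσ.norm_hadamard_deriv_le i _ _).trans
      (mul_le_mul_of_nonneg_left ?_ hσ.pos₁.le)) hmu
    exact (norm_sub_le _ _).trans (add_le_add ((norm_add_le _ _).trans
      (add_le_add (norm_layer_le hX hVy _) (hσ.norm_map_le i _))) (hVx i))
  · rw [norm_smul, Real.norm_of_nonneg hω]

/-- Subtract the multiplier formulas of two consecutive sweeps. Each contains the `V i` and the `U
i` from before its own sweep, hence the lagged increments. The factor 4 is Cauchy-Schwarz for four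
summands. -/
theorem Problem.LocalStep.norm_dual_sub_sq_le {ω ω' : Fin H → ℝ} {w x y : Vars H d q n}
    {Vmax : Fin (H + 1) → ℝ} (hσ : P.ActivationAssumption ψ₀ ψ₁ ψ₂) (hmu : 0 ≤ P.mu)
    (hX : ‖P.X‖ ≤ Vmax 0) (hVx : ∀ i : Fin H, ‖x.V i‖ ≤ Vmax i.succ)
    (hVy : ∀ i : Fin H, ‖y.V i‖ ≤ Vmax i.succ) (h' : P.LocalStep ω' w x)
    (h : P.LocalStep ω x y) (i : Fin H) (hω : 0 ≤ ω i) (hω' : 0 ≤ ω' i) :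
    ‖y.Λ i - x.Λ i‖ ^ 2
      ≤ 4 * ((P.modulus ψ₀ ψ₁ ψ₂ Vmax i + ω i) ^ 2 * ‖y.U i - x.U i‖ ^ 2
        + ω' i ^ 2 * ‖x.U i - w.U i‖ ^ 2
        + P.mu ^ 2 * ψ₁ ^ 2 * ‖layer P.X y i.castSucc - layer P.X x i.castSucc‖ ^ 2
        + P.mu ^ 2 * ψ₁ ^ 2 * ‖x.V i - w.V i‖ ^ 2) := by
  have h1 := hσ.norm_skip_hadamard_sub_le i (layer P.X y i.castSucc) (layer P.X x i.castSucc)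
    (y.U i) (x.U i) (x.V i) (w.V i) (norm_layer_le hX hVy _) (hVx i)
  have h2 : ‖y.Λ i - x.Λ i‖ ≤ (P.modulus ψ₀ ψ₁ ψ₂ Vmax i + ω i) * ‖y.U i - x.U i‖
      + ω' i * ‖x.U i - w.U i‖
      + P.mu * ψ₁ * ‖layer P.X y i.castSucc - layer P.X x i.castSucc‖
      + P.mu * ψ₁ * ‖x.V i - w.V i‖ := by
    rw [h.dual_eq hσ.differentiable i, h'.dual_eq hσ.differentiable i, add_sub_add_comm,
      ← smul_sub]
    refine (norm_add_le _ _).trans ?_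
    have h3 := norm_sub_le (ω i • (y.U i - x.U i)) (ω' i • (x.U i - w.U i))
    rw [norm_smul, norm_smul, Real.norm_of_nonneg hω, Real.norm_of_nonneg hω'] at h3
    rw [norm_smul, Real.norm_of_nonneg hmu, Problem.modulus]
    have h4 := mul_le_mul_of_nonneg_left h1 hmu
    linarith
  refine (pow_le_pow_left₀ (norm_nonneg _) h2 2).trans ?_
  generalize (P.modulus ψ₀ ψ₁ ψ₂ Vmax i + ω i) = m
  generalize ‖y.U i - x.U i‖ = a
  generalize ‖x.U i - w.U i‖ = b
  generalize ‖layer P.X y i.castSucc - layer P.X x i.castSucc‖ = c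
  generalize ‖x.V i - w.V i‖ = e
  simp only [← mul_pow]
  generalize m * a = m
  generalize ω' i * b = b
  generalize P.mu * ψ₁ * c = c
  generalize P.mu * ψ₁ * e = e
  linarith [sq_nonneg (m - b), sq_nonneg (m - c), sq_nonneg (m - e), sq_nonneg (b - c),
    sq_nonneg (b - e), sq_nonneg (c - e)]

end Activation

/-! ### The Lyapunov function -/

/-- The squared length of the primal part of one sweep. -/
def primalSq (x y : Vars H d q n) : ℝ :=
  (∑ i, ‖y.W i - x.W i‖ ^ 2) + ‖y.WN - x.WN‖ ^ 2 + (∑ i, ‖y.U i - x.U i‖ ^ 2)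
    + (∑ i, ‖y.V i - x.V i‖ ^ 2) + ‖y.VN - x.VN‖ ^ 2

/-- The augmented Lagrangian, with the terms that compensate for the dual updates. -/
def Problem.lyapunov (P : Problem H d q n) (θ : ℝ) (ω : Fin H → ℝ) (x y : Vars H d q n) : ℝ :=
  P.lagrangian y + (∑ i, 4 * ω i ^ 2 / P.β i * ‖y.U i - x.U i‖ ^ 2)
    + θ * ∑ i, ‖y.V i - x.V i‖ ^ 2

/-- The terms stored in the old Lyapunov value pay for the lagged part of `‖ΔΛ‖²`. The gain `ω / 2`
in `U` must cover the current part, the new stored term and `κ`; the gain `mu / 2` in `V` must cover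
`θ` twice, for its role as next input and for storage. -/
theorem Problem.LocalStep.lyapunov_descent {P : Problem H d q n} {ψ₀ ψ₁ ψ₂ θ κ : ℝ}
    {ω ω' : Fin H → ℝ} {w x y : Vars H d q n} {Vmax : Fin (H + 1) → ℝ}
    (hσ : P.ActivationAssumption ψ₀ ψ₁ ψ₂) (hmu : 0 ≤ P.mu)
    (hβ : ∀ i, 0 < P.β i) (hβN : 0 < P.βN)
    (hX : ‖P.X‖ ≤ Vmax 0) (hVx : ∀ i : Fin H, ‖x.V i‖ ≤ Vmax i.succ)
    (hVy : ∀ i : Fin H, ‖y.V i‖ ≤ Vmax i.succ) (h' : P.LocalStep ω' w x)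
    (h : P.LocalStep ω x y) (hω : ∀ i, 0 ≤ ω i) (hω' : ∀ i, 0 ≤ ω' i)
    (hθ : ∀ i, 4 * (P.mu ^ 2 * ψ₁ ^ 2) / P.β i ≤ θ) (hκW : κ ≤ P.lam / 2)
    (hκU : ∀ i, κ ≤ ω i / 2 - 4 * (P.modulus ψ₀ ψ₁ ψ₂ Vmax i + ω i) ^ 2 / P.β i
      - 4 * ω i ^ 2 / P.β i)
    (hκV : κ ≤ P.mu / 2 - 2 * θ) (hκN : κ ≤ (1 + P.βN) / 2 - 1 / P.βN) (hθ0 : 0 ≤ θ) :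
    P.lyapunov θ ω x y + κ * primalSq x y ≤ P.lyapunov θ ω' w x := by
  have hdes := h.descent hmu hβ hβN
  have hΛ : ∀ i, 1 / P.β i * ‖y.Λ i - x.Λ i‖ ^ 2
      ≤ 4 * (P.modulus ψ₀ ψ₁ ψ₂ Vmax i + ω i) ^ 2 / P.β i * ‖y.U i - x.U i‖ ^ 2
        + 4 * ω' i ^ 2 / P.β i * ‖x.U i - w.U i‖ ^ 2
        + θ * ‖layer P.X y i.castSucc - layer P.X x i.castSucc‖ ^ 2
        + θ * ‖x.V i - w.V i‖ ^ 2 := fun i => by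
    have h1 := mul_le_mul_of_nonneg_left
      (h'.norm_dual_sub_sq_le hσ hmu hX hVx hVy h i (hω i) (hω' i)) (one_div_pos.mpr (hβ i)).le
    have h2 := mul_le_mul_of_nonneg_right (hθ i)
      (sq_nonneg ‖layer P.X y i.castSucc - layer P.X x i.castSucc‖)
    have h3 := mul_le_mul_of_nonneg_right (hθ i) (sq_nonneg ‖x.V i - w.V i‖)
    refine h1.trans (le_trans (le_of_eq ?_) (add_le_add (add_le_add le_rfl h2) h3))
    ring
  have hU : ∀ i, κ * ‖y.U i - x.U i‖ ^ 2 + 4 * ω i ^ 2 / P.β i * ‖y.U i - x.U i‖ ^ 2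
      + 4 * (P.modulus ψ₀ ψ₁ ψ₂ Vmax i + ω i) ^ 2 / P.β i * ‖y.U i - x.U i‖ ^ 2
      ≤ ω i / 2 * ‖y.U i - x.U i‖ ^ 2 := fun i => by
    rw [← add_mul, ← add_mul]
    exact mul_le_mul_of_nonneg_right (by linarith [hκU i]) (sq_nonneg _)
  have hW : ∀ i, κ * ‖y.W i - x.W i‖ ^ 2 ≤ P.lam / 2 * ‖y.W i - x.W i‖ ^ 2 := fun i =>
    mul_le_mul_of_nonneg_right hκW (sq_nonneg _)
  have hV : ∀ i, (κ + 2 * θ) * ‖y.V i - x.V i‖ ^ 2 ≤ P.mu / 2 * ‖y.V i - x.V i‖ ^ 2 := fun i =>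
    mul_le_mul_of_nonneg_right (by linarith) (sq_nonneg _)
  have hWN : κ * ‖y.WN - x.WN‖ ^ 2 ≤ P.lam / 2 * ‖y.WN - x.WN‖ ^ 2 :=
    mul_le_mul_of_nonneg_right hκW (sq_nonneg _)
  have hVN : (κ + 1 / P.βN) * ‖y.VN - x.VN‖ ^ 2 ≤ (1 + P.βN) / 2 * ‖y.VN - x.VN‖ ^ 2 :=
    mul_le_mul_of_nonneg_right (by linarith) (sq_nonneg _)
  have hΛN : y.ΛN - x.ΛN = y.VN - x.VN := by
    rw [h.dualN_eq, h'.dualN_eq, sub_sub_sub_cancel_right]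
  -- The hidden inputs are `X`, which does not move, and all `V` blocks but the last.
  have hl : θ * ∑ i : Fin H, ‖layer P.X y i.castSucc - layer P.X x i.castSucc‖ ^ 2
      ≤ θ * ∑ i, ‖y.V i - x.V i‖ ^ 2 := by
    refine mul_le_mul_of_nonneg_left ?_ hθ0
    have h1 := Fin.sum_univ_castSucc fun j => ‖layer P.X y j - layer P.X x j‖ ^ 2
    rw [Fin.sum_univ_succ] at h1
    simp only [layer_succ, layer_zero, sub_self, norm_zero, ne_eq, OfNat.ofNat_ne_zero,
      not_false_eq_true, zero_pow, zero_add] at h1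
    rw [h1]
    exact le_add_of_nonneg_right (sq_nonneg _)
  have sΛ := Finset.sum_le_sum fun i (_ : i ∈ Finset.univ) => hΛ i
  have sU := Finset.sum_le_sum fun i (_ : i ∈ Finset.univ) => hU i
  have sW := Finset.sum_le_sum fun i (_ : i ∈ Finset.univ) => hW i
  have sV := Finset.sum_le_sum fun i (_ : i ∈ Finset.univ) => hV i
  rw [hΛN] at hdes
  simp only [Finset.sum_add_distrib, ← Finset.mul_sum] at sΛ sU sW sV hdes
  rw [Problem.lyapunov, Problem.lyapunov, primalSq]
  linarith

/-- A penalty is at least `-‖Λ‖² / (2β)`. In hidden layers the proximal part of the multiplier is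
absorbed by the stored `U` term; at the output `Λ = VN - Y` is offset against the loss. The
quadratic terms kept on the left later bound the weights and the outputs. -/
theorem Problem.LocalStep.le_lyapunov {P : Problem H d q n} {ψ₀ ψ₁ ψ₂ θ : ℝ}
    {ω : Fin H → ℝ} {x y : Vars H d q n} {Vmax : Fin (H + 1) → ℝ}
    (hσ : P.ActivationAssumption ψ₀ ψ₁ ψ₂) (hmu : 0 ≤ P.mu)
    (hβ : ∀ i, 0 < P.β i) (hβN : 0 < P.βN)
    (hX : ‖P.X‖ ≤ Vmax 0) (hVx : ∀ i : Fin H, ‖x.V i‖ ≤ Vmax i.succ)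
    (hVy : ∀ i : Fin H, ‖y.V i‖ ≤ Vmax i.succ)
    (h : P.LocalStep ω x y) (hω : ∀ i, 0 ≤ ω i) (hθ0 : 0 ≤ θ) :
    (∑ i, P.lam / 2 * ‖y.W i‖ ^ 2) + P.lam / 2 * ‖y.WN‖ ^ 2
        + 1 / 2 * (1 - 1 / P.βN) * ‖y.VN - P.Y‖ ^ 2
        - ∑ i, P.dualBound ψ₀ ψ₁ Vmax i ^ 2 / P.β i
      ≤ P.lyapunov θ ω x y := by
  have hΛ : ∀ i, -(P.dualBound ψ₀ ψ₁ Vmax i ^ 2 / P.β i)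
      ≤ P.layerCost y i.castSucc (layer P.X y i.castSucc)
        + 4 * ω i ^ 2 / P.β i * ‖y.U i - x.U i‖ ^ 2 := fun i => by
    have h1 := pow_le_pow_left₀ (norm_nonneg _) (h.norm_dual_le hσ hmu hX hVx hVy i (hω i)) 2
    have hb := hβ i
    have h2 : ‖y.Λ i‖ ^ 2 / (2 * P.β i) ≤ P.dualBound ψ₀ ψ₁ Vmax i ^ 2 / P.β i
        + 4 * ω i ^ 2 / P.β i * ‖y.U i - x.U i‖ ^ 2 := by
      rw [div_mul_eq_mul_div, ← add_div, div_le_div_iff₀ (by positivity) hb]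
      have : ‖y.Λ i‖ ^ 2 ≤ 2 * (P.dualBound ψ₀ ψ₁ Vmax i ^ 2
          + 4 * ω i ^ 2 * ‖y.U i - x.U i‖ ^ 2) := by
        nlinarith [sq_nonneg (P.dualBound ψ₀ ψ₁ Vmax i - ω i * ‖y.U i - x.U i‖),
          sq_nonneg (ω i * ‖y.U i - x.U i‖)]
      calc _ ≤ _ := mul_le_mul_of_nonneg_right this hb.le
        _ = _ := by ring
    rw [P.layerCost_castSucc, penalty_eq hb.ne']
    have h3 : 0 ≤ P.mu / 2 * ‖layer P.X y i.castSucc + (y.U i).map (P.σ i) - y.V i‖ ^ 2 := by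
      positivity
    have h4 : 0 ≤ P.β i / 2 * ‖y.W i * layer P.X y i.castSucc - y.U i
        + (1 / P.β i) • y.Λ i‖ ^ 2 := by positivity
    linarith
  have hN : -(1 / P.βN * (1 / 2) * ‖y.VN - P.Y‖ ^ 2)
      ≤ P.layerCost y (Fin.last H) (layer P.X y (Fin.last H)) := by
    rw [P.layerCost_last, penalty_eq hβN.ne', h.dualN_eq]
    have h4 : 0 ≤ P.βN / 2 * ‖y.WN * layer P.X y (Fin.last H) - y.VN
        + (1 / P.βN) • (y.VN - P.Y)‖ ^ 2 := by positivity
    have : ‖y.VN - P.Y‖ ^ 2 / (2 * P.βN) = 1 / P.βN * (1 / 2) * ‖y.VN - P.Y‖ ^ 2 := by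
      field_simp
    linarith
  have sΛ := Finset.sum_le_sum fun i (_ : i ∈ Finset.univ) => hΛ i
  rw [Finset.sum_neg_distrib, Finset.sum_add_distrib] at sΛ
  have hθ : 0 ≤ θ * ∑ i, ‖y.V i - x.V i‖ ^ 2 :=
    mul_nonneg hθ0 (Finset.sum_nonneg fun i _ => sq_nonneg _)
  rw [Problem.lyapunov, P.lagrangian_eq, Fin.sum_univ_castSucc]
  linarith

/-! ### The gradient is controlled by the increments of one sweep -/

/-- A bound for the gradient in a weight block, per unit length of the increments. -/
def weightConst (B : ℝ) : ℝ := 3 * B + (1 + B * (B + 1)) * B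

/-- Stationarity holds at the old `V`, `U` and `Λ`, so only the effect of replacing them is left.
The new bracket is `Λ' + (Λ' - Λ)`, of norm at most `3 * B`. -/
theorem norm_weight_grad_le {a b c : ℕ} {r β B η : ℝ} {y : Matrix (Fin a) (Fin b) ℝ}
    {V V' : Matrix (Fin b) (Fin c) ℝ} {Λ Λ' U U' : Matrix (Fin a) (Fin c) ℝ}
    (hβ : 0 ≤ β) (hB : 0 ≤ B) (hη : 0 ≤ η)
    (h : r • y + (Λ + β • (y * V - U)) * Vᵀ = 0) (hd : Λ' = Λ + β • (y * V' - U'))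
    (hβB : β ≤ B) (hy : ‖y‖ ≤ B) (hV : ‖V‖ ≤ B) (hΛ : ‖Λ‖ ≤ B) (hΛ' : ‖Λ'‖ ≤ B)
    (hdV : ‖V' - V‖ ≤ η) (hdU : ‖U' - U‖ ≤ η) (hdΛ : ‖Λ' - Λ‖ ≤ η) :
    ‖r • y + (Λ' + β • (y * V' - U')) * V'ᵀ‖ ≤ weightConst B * η := by
  have hd' : β • (y * V' - U') = Λ' - Λ := by rw [hd, add_sub_cancel_left]
  have hsplit : r • y + (Λ' + β • (y * V' - U')) * V'ᵀ
      = (Λ' + (Λ' - Λ)) * (V' - V)ᵀ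
        + ((Λ' - Λ) + β • (y * (V' - V) - (U' - U))) * Vᵀ := by
    have e : (Λ' - Λ) + β • (y * (V' - V) - (U' - U))
        = (Λ' + (Λ' - Λ)) - (Λ + β • (y * V - U)) := by
      rw [Matrix.mul_sub, show y * V' - y * V - (U' - U) = (y * V' - U') - (y * V - U) by abel,
        smul_sub, hd']
      abel
    rw [e, hd', Matrix.transpose_sub, Matrix.mul_sub, Matrix.sub_mul, ← sub_eq_zero,
      ← sub_eq_zero.mpr h]
    abel
  have h1 : ‖Λ' + (Λ' - Λ)‖ ≤ 3 * B :=
    (norm_add_le _ _).trans (by linarith [norm_sub_le Λ' Λ])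
  have h2 : ‖(Λ' - Λ) + β • (y * (V' - V) - (U' - U))‖ ≤ (1 + B * (B + 1)) * η := by
    have h3 : ‖y * (V' - V) - (U' - U)‖ ≤ (B + 1) * η := by
      have := (norm_mul_mul_le y (V' - V)).trans (mul_le_mul hy hdV (norm_nonneg _) hB)
      exact (norm_sub_le _ _).trans (by linarith)
    have h4 : ‖β • (y * (V' - V) - (U' - U))‖ ≤ B * ((B + 1) * η) := by
      rw [norm_smul, Real.norm_of_nonneg hβ]
      exact mul_le_mul hβB h3 (norm_nonneg _) hB
    exact (norm_add_le _ _).trans (by linarith)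
  rw [hsplit, weightConst]
  rw [← Matrix.frobenius_norm_transpose] at hV hdV
  have h5 := (norm_mul_mul_le (Λ' + (Λ' - Λ)) (V' - V)ᵀ).trans
    (mul_le_mul h1 hdV (norm_nonneg _) (by linarith))
  have h6 := (norm_mul_mul_le ((Λ' - Λ) + β • (y * (V' - V) - (U' - U))) Vᵀ).trans
    (mul_le_mul h2 hV (norm_nonneg _) (by positivity))
  exact (norm_add_le _ _).trans (by linarith)

/-- All blocks that occur in a sweep from `x` to `y`, and the parameters, are bounded by `B`. -/
structure Problem.StepBounds (P : Problem H d q n) (ψ₁ : ℝ) (ω : Fin H → ℝ) (B : ℝ)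
    (x y : Vars H d q n) : Prop where
  ψ₁ : ψ₁ ≤ B
  mu : P.mu ≤ B
  β : ∀ i, P.β i ≤ B
  β_inv : ∀ i, 1 / P.β i ≤ B
  βN : P.βN ≤ B
  βN_inv : 1 / P.βN ≤ B
  ω : ∀ i, ω i ≤ B
  W : ∀ i, ‖y.W i‖ ≤ B
  WN : ‖y.WN‖ ≤ B
  layer : ∀ j, ‖layer P.X x j‖ ≤ B
  Λ : ∀ i, ‖x.Λ i‖ ≤ B
  Λ' : ∀ i, ‖y.Λ i‖ ≤ B
  ΛN : ‖x.ΛN‖ ≤ B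
  ΛN' : ‖y.ΛN‖ ≤ B

/-- The increments of a sweep from `x` to `y` are bounded by `η`. -/
structure IncrBounds (η : ℝ) (x y : Vars H d q n) : Prop where
  U : ∀ i, ‖y.U i - x.U i‖ ≤ η
  V : ∀ i, ‖y.V i - x.V i‖ ≤ η
  VN : ‖y.VN - x.VN‖ ≤ η
  Λ : ∀ i, ‖y.Λ i - x.Λ i‖ ≤ η
  ΛN : ‖y.ΛN - x.ΛN‖ ≤ η

theorem norm_layer_sub_le (X : Matrix (Fin d) (Fin n) ℝ) {x y : Vars H d q n} {η : ℝ} (hη : 0 ≤ η)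
    (h : ∀ i, ‖y.V i - x.V i‖ ≤ η) (j : Fin (H + 1)) : ‖layer X y j - layer X x j‖ ≤ η := by
  induction j using Fin.cases with
  | zero => simpa [layer_zero] using hη
  | succ i => simpa [layer_succ] using h i

/-- A bound for the gradient of the augmented Lagrangian, per unit length of the increments. -/
def gradConst (H : ℕ) (B : ℝ) : ℝ :=
  H * (weightConst B + (B * B + B + 1) + 2 * B * (B + 1) + B) + weightConst B + 1 + B

namespace Problem.LocalStep

variable {P : Problem H d q n} {ψ₀ ψ₁ ψ₂ B η : ℝ} {ω : Fin H → ℝ} {x y : Vars H d q n}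

/-- Relative to the stationary `U` problem, the gradient has the new `V i`, no proximal term, and a
further multiplier increment, because the residual is added to the already updated multiplier. -/
theorem norm_gradU_le (hσ : P.ActivationAssumption ψ₀ ψ₁ ψ₂) (hmu : 0 ≤ P.mu)
    (hω : ∀ i, 0 ≤ ω i) (hB : 0 ≤ B) (h : P.LocalStep ω x y)
    (hb : P.StepBounds ψ₁ ω B x y) (hi : IncrBounds η x y) (i : Fin H) :
    ‖P.gradU y i‖ ≤ (B * B + B + 1) * η := by
  have e : P.gradU y i = P.mu • ((x.V i - y.V i) ⊙ (y.U i).map (deriv (P.σ i)))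
      - ω i • (y.U i - x.U i) - (y.Λ i - x.Λ i) := by
    have h1 : P.β i • P.linRes y i = y.Λ i - x.Λ i := by
      rw [h.dual.Λ i, add_sub_cancel_left, Problem.linRes]
    have h2 : x.V i - y.V i = P.skipRes y i
        - (ResNetADMM.layer P.X y i.castSucc + (y.U i).map (P.σ i) - x.V i) := by
      rw [Problem.skipRes]
      abel
    have h3 := (h.dual_eq hσ.differentiable i).symm
    have h4 : ∀ A C D : Matrix (Fin d) (Fin n) ℝ, (A - C) ⊙ D = A ⊙ D - C ⊙ D := fun A C D => by
      ext
      simp [sub_mul]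
    rw [Problem.gradU, h1, h2, h4, smul_sub]
    rw [← sub_eq_zero] at h3 ⊢
    rw [← h3]
    abel
  rw [e]
  have h1 : ‖P.mu • ((x.V i - y.V i) ⊙ (y.U i).map (deriv (P.σ i)))‖ ≤ B * (B * η) := by
    rw [norm_smul, Real.norm_of_nonneg hmu]
    refine mul_le_mul hb.mu ((hσ.norm_hadamard_deriv_le i _ _).trans ?_) (norm_nonneg _) hB
    rw [norm_sub_rev]
    exact mul_le_mul hb.ψ₁ (hi.V i) (norm_nonneg _) hB
  have h2 : ‖ω i • (y.U i - x.U i)‖ ≤ B * η := by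
    rw [norm_smul, Real.norm_of_nonneg (hω i)]
    exact mul_le_mul (hb.ω i) (hi.U i) (norm_nonneg _) hB
  refine (norm_sub_le _ _).trans ?_
  linarith [norm_sub_le (P.mu • ((x.V i - y.V i) ⊙ (y.U i).map (deriv (P.σ i))))
    (ω i • (y.U i - x.U i)), hi.Λ i]

/-- `V i` is stationary against the next layer with new weights and otherwise old blocks.
Subtracting leaves two values of `layerGrad` at the same input and weights. -/
theorem norm_gradV_le (hσ : P.ActivationAssumption ψ₀ ψ₁ ψ₂) (hmu : 0 ≤ P.mu)
    (hβ : ∀ i, 0 ≤ P.β i) (hβN : 0 ≤ P.βN) (hB : 0 ≤ B) (hη : 0 ≤ η) (h : P.LocalStep ω x y)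
    (hb : P.StepBounds ψ₁ ω B x y) (hi : IncrBounds η x y) (i : Fin H) :
    ‖P.gradV y i‖ ≤ 2 * B * (B + 1) * η := by
  have e : P.gradV y i = P.layerGrad y i.succ (y.V i)
      - P.layerGrad (withWeights x y) i.succ (y.V i) := by
    rw [Problem.gradV, ← sub_eq_zero.mp (h.V_eq i)]
  rw [e]
  have hmul : ∀ {a b c : ℕ} {s : ℝ} (A : Matrix (Fin a) (Fin b) ℝ)
      (L L' U U' R : Matrix (Fin a) (Fin c) ℝ), 0 ≤ s → s ≤ B → ‖A‖ ≤ B → ‖L - L'‖ ≤ η →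
      ‖U - U'‖ ≤ η → ‖Aᵀ * (L + s • (R - U)) - Aᵀ * (L' + s • (R - U'))‖ ≤ B * (B + 1) * η := by
    intro a b c s A L L' U U' R hs hsB hA hL hU
    rw [← Matrix.mul_sub, show L + s • (R - U) - (L' + s • (R - U'))
      = (L - L') - s • (U - U') by simp only [smul_sub]; abel]
    have h1 : ‖s • (U - U')‖ ≤ B * η := by
      rw [norm_smul, Real.norm_of_nonneg hs]
      exact mul_le_mul hsB hU (norm_nonneg _) hB
    have h2 : ‖(L - L') - s • (U - U')‖ ≤ (B + 1) * η :=
      (norm_sub_le _ _).trans (by linarith)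
    rw [mul_assoc]
    refine (norm_mul_mul_le _ _).trans (mul_le_mul ?_ h2 (norm_nonneg _) hB)
    rwa [Matrix.frobenius_norm_transpose]
  generalize i.succ = j
  induction j using Fin.lastCases with
  | last =>
    rw [P.layerGrad_last, P.layerGrad_last]
    have := hmul y.WN y.ΛN x.ΛN y.VN x.VN (y.WN * y.V i) hβN hb.βN hb.WN hi.ΛN hi.VN
    have h0 : 0 ≤ B * (B + 1) * η := by positivity
    exact this.trans (by linarith)
  | cast j =>
    rw [P.layerGrad_castSucc, P.layerGrad_castSucc]
    have h1 := hmul (y.W j) (y.Λ j) (x.Λ j) (y.U j) (x.U j) (y.W j * y.V i) (hβ j) (hb.β j)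
      (hb.W j) (hi.Λ j) (hi.U j)
    have h2 : ‖P.mu • (y.V i + (y.U j).map (P.σ j) - y.V j)
        - P.mu • (y.V i + (x.U j).map (P.σ j) - x.V j)‖ ≤ B * (B + 1) * η := by
      rw [← smul_sub, norm_smul, Real.norm_of_nonneg hmu,
        show y.V i + (y.U j).map (P.σ j) - y.V j - (y.V i + (x.U j).map (P.σ j) - x.V j)
          = ((y.U j).map (P.σ j) - (x.U j).map (P.σ j)) - (y.V j - x.V j) by abel, mul_assoc]
      have h3 := (hσ.norm_map_sub_le j (y.U j) (x.U j)).trans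
        (mul_le_mul hb.ψ₁ (hi.U j) (norm_nonneg _) hB)
      exact mul_le_mul hb.mu ((norm_sub_le _ _).trans (by linarith [hi.V j])) (norm_nonneg _) hB
    simp only [withWeights]
    rw [add_sub_add_comm]
    exact (norm_add_le _ _).trans (by linarith)

/-- The gradient of the augmented Lagrangian at the end of a sweep is controlled by the increments
of the sweep. -/
theorem gradNorm_le (hσ : P.ActivationAssumption ψ₀ ψ₁ ψ₂) (hmu : 0 ≤ P.mu)
    (hβ : ∀ i, 0 < P.β i) (hβN : 0 < P.βN) (hω : ∀ i, 0 ≤ ω i) (hB : 0 ≤ B) (hη : 0 ≤ η)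
    (h : P.LocalStep ω x y) (hb : P.StepBounds ψ₁ ω B x y) (hi : IncrBounds η x y) :
    P.gradNorm y ≤ gradConst H B * η := by
  refine (P.gradNorm_le hσ.differentiable y).trans ?_
  -- By the dual update a constraint residual is the multiplier increment divided by `β`.
  have hres : ∀ {a b : ℕ} {s : ℝ} {R L L' : Matrix (Fin a) (Fin b) ℝ}, 0 < s → 1 / s ≤ B →
      L' = L + s • R → ‖L' - L‖ ≤ η → ‖R‖ ≤ B * η := by
    intro a b s R L L' hs hsB hL hd
    rw [hL, add_sub_cancel_left, norm_smul, Real.norm_of_nonneg hs.le] at hd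
    calc ‖R‖ = 1 / s * (s * ‖R‖) := by field_simp
      _ ≤ B * η := mul_le_mul hsB hd (by positivity) hB
  have hl := norm_layer_sub_le P.X hη hi.V
  have hW : ∀ i, ‖P.gradW y i‖ ≤ weightConst B * η := fun i =>
    norm_weight_grad_le (hβ i).le hB hη (h.W_eq i) (h.dual.Λ i) (hb.β i) (hb.W i) (hb.layer _)
      (hb.Λ i) (hb.Λ' i) (hl _) (hi.U i) (hi.Λ i)
  have hWN : ‖P.gradWN y‖ ≤ weightConst B * η :=
    norm_weight_grad_le hβN.le hB hη h.WN_eq h.dual.ΛN hb.βN hb.WN (hb.layer _)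
      hb.ΛN hb.ΛN' (hl _) hi.VN hi.ΛN
  have hU := h.norm_gradU_le hσ hmu hω hB hb hi
  have hV := h.norm_gradV_le hσ hmu (fun i => (hβ i).le) hβN.le hB hη hb hi
  have hR : ∀ i, ‖P.linRes y i‖ ≤ B * η := fun i =>
    hres (hβ i) (hb.β_inv i) (h.dual.Λ i) (hi.Λ i)
  have hRN : ‖P.linResN y‖ ≤ B * η := hres hβN hb.βN_inv h.dual.ΛN hi.ΛN
  have hVN : ‖P.gradVN y‖ ≤ η := by
    have e : P.gradVN y = -(y.ΛN - x.ΛN) := by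
      have h1 : P.βN • P.linResN y = y.ΛN - x.ΛN := by
        rw [h.dual.ΛN, add_sub_cancel_left, Problem.linResN]
      rw [Problem.gradVN, h1, ← h.dualN_eq]
      abel
    rw [e, norm_neg]
    exact hi.ΛN
  have hsum : ∑ i, (‖P.gradW y i‖ + ‖P.gradU y i‖ + ‖P.gradV y i‖ + ‖P.linRes y i‖)
      ≤ ∑ _i : Fin H, (weightConst B + (B * B + B + 1) + 2 * B * (B + 1) + B) * η :=
    Finset.sum_le_sum fun i _ => by linarith [hW i, hU i, hV i, hR i]
  rw [Finset.sum_const, Finset.card_univ, Fintype.card_fin, nsmul_eq_mul] at hsum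
  rw [gradConst]
  linarith

end Problem.LocalStep

/-! ### Summability of the squared gradient norms -/

theorem exists_pos_forall_le {ι : Type*} [Finite ι] {f : ι → ℝ} (hf : ∀ i, 0 < f i) :
    ∃ δ > 0, ∀ i, δ ≤ f i := by
  cases isEmpty_or_nonempty ι
  -- A network without hidden layers: any positive number serves.
  · exact ⟨1, one_pos, fun i => isEmptyElim i⟩
  · obtain ⟨i, hi⟩ := Finite.exists_min f
    exact ⟨f i, hf i, hi⟩

theorem exists_forall_le {ι : Type*} [Finite ι] (f : ι → ℝ) : ∃ B, 0 ≤ B ∧ ∀ i, f i ≤ B := by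
  obtain ⟨B, hB⟩ := Finite.bddAbove_range f
  exact ⟨max 0 B, le_max_left _ _, fun i => (hB ⟨i, rfl⟩).trans (le_max_right _ _)⟩

/-! ### Consequences of the conditions on the penalty and proximal parameters -/

section Parameters

variable {P : Problem H d q n} {ψ₀ ψ₁ ψ₂ : ℝ} {Vmax : Fin (H + 1) → ℝ}

theorem Problem.PenaltyAssumption.Vmax_pos' (hβ : P.PenaltyAssumption ψ₀ ψ₁ ψ₂ Vmax)
    (j : Fin (H + 1)) : 0 < Vmax j := by
  induction j using Fin.cases with
  | zero => exact (norm_nonneg _).trans_lt hβ.Vmax_zero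
  | succ i => exact hβ.Vmax_pos i

theorem Problem.PenaltyAssumption.modulus_pos (hβ : P.PenaltyAssumption ψ₀ ψ₁ ψ₂ Vmax)
    (hσ : P.ActivationAssumption ψ₀ ψ₁ ψ₂) (hmu : 0 < P.mu) (i : Fin H) :
    0 < P.modulus ψ₀ ψ₁ ψ₂ Vmax i := by
  have h0 := hσ.pos₀
  have h1 := hσ.pos₁
  have h2 := hσ.pos₂
  have h3 := hβ.Vmax_pos' i.succ
  have h4 := hβ.Vmax_pos' i.castSucc
  rw [Problem.modulus]
  positivity

theorem Problem.PenaltyAssumption.modulus_lt (hβ : P.PenaltyAssumption ψ₀ ψ₁ ψ₂ Vmax)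
    (hσ : P.ActivationAssumption ψ₀ ψ₁ ψ₂) (hmu : 0 < P.mu) (i : Fin H) :
    64 * P.modulus ψ₀ ψ₁ ψ₂ Vmax i < P.β i := by
  have h1 := (le_max_left _ _).trans_lt (hβ.β i)
  have h2 : (1 : ℝ) ≤ √2 := Real.one_le_sqrt.mpr one_le_two
  nlinarith [hβ.modulus_pos hσ hmu i]

theorem Problem.PenaltyAssumption.β_pos (hβ : P.PenaltyAssumption ψ₀ ψ₁ ψ₂ Vmax)
    (hσ : P.ActivationAssumption ψ₀ ψ₁ ψ₂) (hmu : 0 < P.mu) (i : Fin H) : 0 < P.β i := by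
  linarith [hβ.modulus_lt hσ hmu i, hβ.modulus_pos hσ hmu i]

/-- There is some slack in the lower bound `16 μ ψ₁² < β_i`, uniformly in the layer. -/
theorem Problem.PenaltyAssumption.exists_slack (hβ : P.PenaltyAssumption ψ₀ ψ₁ ψ₂ Vmax)
    (hσ : P.ActivationAssumption ψ₀ ψ₁ ψ₂) (hmu : 0 < P.mu) :
    ∃ θ, 0 ≤ θ ∧ θ < P.mu / 4 ∧ ∀ i, 4 * (P.mu ^ 2 * ψ₁ ^ 2) / P.β i ≤ θ := by
  have h : ∀ i, 0 < P.mu / 4 - 4 * (P.mu ^ 2 * ψ₁ ^ 2) / P.β i := fun i => by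
    have h1 := (le_max_right _ _).trans_lt (hβ.β i)
    rw [sub_pos, div_lt_div_iff₀ (hβ.β_pos hσ hmu i) (by norm_num)]
    nlinarith
  obtain ⟨δ, hδ, hle⟩ := exists_pos_forall_le h
  -- `θ < P.mu / 4` is what keeps `P.mu / 2 - 2 * θ` positive; the `max` only ensures `0 ≤ θ`.
  refine ⟨max 0 (P.mu / 4 - δ), le_max_left _ _, max_lt (by linarith) (by linarith), fun i => ?_⟩
  exact le_trans (by linarith [hle i]) (le_max_right _ _)

variable {ω : ℕ → Fin H → ℝ} {e' e : Fin H → ℝ}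

theorem Problem.ProximalAssumption.disc_pos (hω : P.ProximalAssumption ψ₀ ψ₁ ψ₂ Vmax ω e' e)
    (i : Fin H) : 0 < P.disc ψ₀ ψ₁ ψ₂ Vmax i := by
  have h1 := hω.e'_pos i
  have h2 := hω.e'_lt i
  exact Real.sqrt_pos.mp (by linarith)

theorem Problem.ProximalAssumption.ωmin_pos (hω : P.ProximalAssumption ψ₀ ψ₁ ψ₂ Vmax ω e' e)
    (i : Fin H) : 0 < P.ωmin ψ₀ ψ₁ ψ₂ Vmax i (e' i) := by
  linarith [hω.e_pos i, hω.e_lt i]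

theorem Problem.ProximalAssumption.ω_pos (hω : P.ProximalAssumption ψ₀ ψ₁ ψ₂ Vmax ω e' e)
    (k : ℕ) (i : Fin H) : 0 < ω k i :=
  (hω.ωmin_pos i).trans (hω.lower k i)

/-- The proximal parameters lie strictly between the roots of
`8 ω² - (β/4 - 8M) ω + 4 M²`. -/
theorem Problem.ProximalAssumption.quadratic_lt
    (hω : P.ProximalAssumption ψ₀ ψ₁ ψ₂ Vmax ω e' e) (k : ℕ) (i : Fin H) :
    4 * (P.modulus ψ₀ ψ₁ ψ₂ Vmax i + ω k i) ^ 2 + 4 * ω k i ^ 2 < P.β i * ω k i / 4 := by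
  have hs := Real.sq_sqrt (hω.disc_pos i).le
  have hl := hω.lower k i
  have hu := (hω.upper k i).trans_le (min_le_left _ _)
  have he := hω.e'_pos i
  rw [Problem.ωmin] at hl
  set s := √(P.disc ψ₀ ψ₁ ψ₂ Vmax i)
  rw [Problem.disc] at hs
  set M := P.modulus ψ₀ ψ₁ ψ₂ Vmax i
  have h1 : 0 < 16 * ω k i - (P.β i / 4 - 8 * M - s) := by linarith
  have h2 : 0 < (P.β i / 4 - 8 * M + s) - 16 * ω k i := by linarith
  -- The product of the scaled distances to the two roots is 32 times the desired difference.
  nlinarith [mul_pos h1 h2]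

/-- By `quadratic_lt`, the multiplier terms use up at most `ω / 4` of the gain `ω / 2`. -/
theorem Problem.ProximalAssumption.le_coeff
    (hω : P.ProximalAssumption ψ₀ ψ₁ ψ₂ Vmax ω e' e) (hβ : ∀ i, 0 < P.β i) (k : ℕ) (i : Fin H) :
    P.ωmin ψ₀ ψ₁ ψ₂ Vmax i (e' i) / 4
      ≤ ω k i / 2 - 4 * (P.modulus ψ₀ ψ₁ ψ₂ Vmax i + ω k i) ^ 2 / P.β i
        - 4 * ω k i ^ 2 / P.β i := by
  have h1 : (4 * (P.modulus ψ₀ ψ₁ ψ₂ Vmax i + ω k i) ^ 2 + 4 * ω k i ^ 2) / P.β i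
      ≤ ω k i / 4 := by
    rw [div_le_iff₀ (hβ i)]
    linarith [hω.quadratic_lt k i]
  rw [add_div] at h1
  linarith [hω.lower k i]

end Parameters

/-! ### Increments and telescoping -/

theorem primalSq_nonneg (x y : Vars H d q n) : 0 ≤ primalSq x y := by
  rw [primalSq]
  positivity

theorem norm_U_sub_sq_le (x y : Vars H d q n) (i : Fin H) :
    ‖y.U i - x.U i‖ ^ 2 ≤ primalSq x y := by
  have h := Finset.single_le_sum (f := fun i => ‖y.U i - x.U i‖ ^ 2)
    (fun _ _ => sq_nonneg _) (Finset.mem_univ i)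
  have h1 : 0 ≤ ∑ i, ‖y.W i - x.W i‖ ^ 2 := by positivity
  have h2 : 0 ≤ ∑ i, ‖y.V i - x.V i‖ ^ 2 := by positivity
  rw [primalSq]
  linarith [sq_nonneg ‖y.WN - x.WN‖, sq_nonneg ‖y.VN - x.VN‖]

theorem norm_V_sub_sq_le (x y : Vars H d q n) (i : Fin H) :
    ‖y.V i - x.V i‖ ^ 2 ≤ primalSq x y := by
  have h := Finset.single_le_sum (f := fun i => ‖y.V i - x.V i‖ ^ 2)
    (fun _ _ => sq_nonneg _) (Finset.mem_univ i)
  have h1 : 0 ≤ ∑ i, ‖y.W i - x.W i‖ ^ 2 := by positivity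
  have h2 : 0 ≤ ∑ i, ‖y.U i - x.U i‖ ^ 2 := by positivity
  rw [primalSq]
  linarith [sq_nonneg ‖y.WN - x.WN‖, sq_nonneg ‖y.VN - x.VN‖]

theorem norm_VN_sub_sq_le (x y : Vars H d q n) : ‖y.VN - x.VN‖ ^ 2 ≤ primalSq x y := by
  have h1 : 0 ≤ ∑ i, ‖y.W i - x.W i‖ ^ 2 := by positivity
  have h2 : 0 ≤ ∑ i, ‖y.U i - x.U i‖ ^ 2 := by positivity
  have h3 : 0 ≤ ∑ i, ‖y.V i - x.V i‖ ^ 2 := by positivity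
  rw [primalSq]
  linarith [sq_nonneg ‖y.WN - x.WN‖]

/-- If a function decreases by at least `κ D` in each step and is bounded below, then `D` has
bounded partial sums. -/
theorem sum_le_of_descent {E D : ℕ → ℝ} {κ C : ℝ} (hκ : 0 < κ)
    (hE : ∀ k, E (k + 1) + κ * D (k + 1) ≤ E k) (hC : ∀ k, -C ≤ E k) (m : ℕ) :
    ∑ k ∈ Finset.range (m + 1), D k ≤ D 0 + (E 0 + C) / κ := by
  have h : ∀ m, E m + κ * ∑ k ∈ Finset.range m, D (k + 1) ≤ E 0 := fun m => by
    induction m with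
    | zero => simp
    | succ m ih =>
      rw [Finset.sum_range_succ, mul_add]
      linarith [hE m]
  rw [Finset.sum_range_succ', add_comm]
  refine add_le_add le_rfl ?_
  rw [le_div_iff₀ hκ]
  linarith [h m, hC m]

theorem le_of_half_mul_sq_le {r t R : ℝ} (hr : 0 < r) (h : r / 2 * t ^ 2 ≤ R) :
    t ≤ √(2 * R / r) := by
  refine Real.le_sqrt_of_sq_le ?_
  rw [le_div_iff₀ hr]
  linarith

/-! ### Uniform bounds along a run -/

section Run

variable {P : Problem H d q n} {ψ₀ ψ₁ ψ₂ : ℝ} {Vmax : Fin (H + 1) → ℝ}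
  {ω : ℕ → Fin H → ℝ} {e' e : Fin H → ℝ} {x : ℕ → Vars H d q n}

/-- Along a run, the squared primal increments have bounded partial sums, and the weights and the
output residual stay bounded. -/
theorem Problem.exists_primal_bounds (hlam : 0 < P.lam) (hmu : 0 < P.mu)
    (hσ : P.ActivationAssumption ψ₀ ψ₁ ψ₂) (hβ : P.PenaltyAssumption ψ₀ ψ₁ ψ₂ Vmax)
    (hω : P.ProximalAssumption ψ₀ ψ₁ ψ₂ Vmax ω e' e)
    (hx : ∀ k, P.LocalStep (ω k) (x k) (x (k + 1)))
    (hV : ∀ k (i : Fin H), ‖(x k).V i‖ ≤ Vmax i.succ) :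
    ∃ B, 0 ≤ B ∧ (∀ m, ∑ k ∈ Finset.range (m + 1), primalSq (x k) (x (k + 1)) ≤ B)
      ∧ (∀ k i, ‖(x (k + 1)).W i‖ ≤ B) ∧ (∀ k, ‖(x (k + 1)).WN‖ ≤ B)
      ∧ (∀ k, ‖(x (k + 1)).VN - P.Y‖ ≤ B) := by
  have hβ0 := hβ.β_pos hσ hmu
  have hβN : 0 < P.βN := one_pos.trans hβ.βN
  have hX := hβ.Vmax_zero.le
  have hω0 : ∀ k i, 0 ≤ ω k i := fun k i => (hω.ω_pos k i).le
  have hNinv : 1 / P.βN < 1 := by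
    rw [div_lt_one hβN]
    exact hβ.βN
  obtain ⟨θ, hθ0, hθ1, hθ⟩ := hβ.exists_slack hσ hmu
  obtain ⟨δ, hδ, hδle⟩ := exists_pos_forall_le fun i => div_pos (hω.ωmin_pos i) four_pos
  -- The smallest of the net gains in the weights, `U`, `V` and the output.
  obtain ⟨κ, hκ, hκle⟩ : ∃ κ > 0, κ ≤ P.lam / 2 ∧ κ ≤ δ ∧ κ ≤ P.mu / 2 - 2 * θ
      ∧ κ ≤ (1 + P.βN) / 2 - 1 / P.βN :=
    ⟨min (P.lam / 2) (min δ (min (P.mu / 2 - 2 * θ) ((1 + P.βN) / 2 - 1 / P.βN))),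
      lt_min (by linarith) (lt_min hδ (lt_min (by linarith) (by linarith [hβ.βN]))), by simp⟩
  obtain ⟨hκW, hκU, hκV, hκN⟩ := hκle
  set E : ℕ → ℝ := fun k => P.lyapunov θ (ω k) (x k) (x (k + 1))
  set D : ℕ → ℝ := fun k => primalSq (x k) (x (k + 1))
  set C : ℝ := ∑ i, P.dualBound ψ₀ ψ₁ Vmax i ^ 2 / P.β i
  have hdesc : ∀ k, E (k + 1) + κ * D (k + 1) ≤ E k := fun k =>
    (hx k).lyapunov_descent hσ hmu.le hβ0 hβN hX (hV _) (hV _) (hx (k + 1)) (hω0 _) (hω0 _) hθ hκW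
      (fun i => (hκU.trans (hδle i)).trans (hω.le_coeff hβ0 _ i)) hκV hκN hθ0
  have hlow : ∀ k, (∑ i, P.lam / 2 * ‖(x (k + 1)).W i‖ ^ 2) + P.lam / 2 * ‖(x (k + 1)).WN‖ ^ 2
        + 1 / 2 * (1 - 1 / P.βN) * ‖(x (k + 1)).VN - P.Y‖ ^ 2 - C ≤ E k := fun k =>
    (hx k).le_lyapunov hσ hmu.le hβ0 hβN hX (hV _) (hV _) (hω0 _) hθ0
  have hsW : ∀ k, 0 ≤ ∑ i, P.lam / 2 * ‖(x (k + 1)).W i‖ ^ 2 := fun k =>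
    Finset.sum_nonneg fun i _ => by positivity
  have hsWN : ∀ k, 0 ≤ P.lam / 2 * ‖(x (k + 1)).WN‖ ^ 2 := fun k => by positivity
  have hc : 0 < 1 - 1 / P.βN := by linarith
  have hsVN : ∀ k, 0 ≤ 1 / 2 * (1 - 1 / P.βN) * ‖(x (k + 1)).VN - P.Y‖ ^ 2 := fun k => by
    positivity
  have hC : ∀ k, -C ≤ E k := fun k => by linarith [hlow k, hsW k, hsWN k, hsVN k]
  have hanti : ∀ k, E k ≤ E 0 := fun k => by
    induction k with
    | zero => exact le_rfl
    | succ k ih => linarith [hdesc k, mul_nonneg hκ.le (primalSq_nonneg (x (k + 1)) (x (k + 2)))]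
  have hR : 0 ≤ E 0 + C := by linarith [hC 0]
  have hD0 : 0 ≤ D 0 := primalSq_nonneg _ _
  have hS0 : 0 ≤ D 0 + (E 0 + C) / κ := by positivity
  -- `E 0 + C` is the total decrease available. `D 0` is added because the descent compares two
  -- sweeps and so says nothing about the first. The roots bound the weights and the output
  -- residual, whose quadratic terms are at most `E 0 + C`.
  refine ⟨(D 0 + (E 0 + C) / κ) + √(2 * (E 0 + C) / P.lam) + √(2 * (E 0 + C) / (1 - 1 / P.βN)),
    by positivity, fun m => ?_, fun k i => ?_, fun k => ?_, fun k => ?_⟩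
  · have := sum_le_of_descent hκ hdesc hC m
    linarith [Real.sqrt_nonneg (2 * (E 0 + C) / P.lam),
      Real.sqrt_nonneg (2 * (E 0 + C) / (1 - 1 / P.βN))]
  · have h1 := Finset.single_le_sum (f := fun i => P.lam / 2 * ‖(x (k + 1)).W i‖ ^ 2)
      (fun _ _ => by positivity) (Finset.mem_univ i)
    have := le_of_half_mul_sq_le hlam (t := ‖(x (k + 1)).W i‖) (R := E 0 + C)
      (by linarith [hlow k, hsWN k, hsVN k, hanti k])
    linarith [Real.sqrt_nonneg (2 * (E 0 + C) / (1 - 1 / P.βN))]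
  · have := le_of_half_mul_sq_le hlam (t := ‖(x (k + 1)).WN‖) (R := E 0 + C)
      (by linarith [hlow k, hsW k, hsVN k, hanti k])
    linarith [Real.sqrt_nonneg (2 * (E 0 + C) / (1 - 1 / P.βN))]
  · have := le_of_half_mul_sq_le hc (t := ‖((x (k + 1)).VN - P.Y)‖) (R := E 0 + C)
      (by linarith [hlow k, hsW k, hsWN k, hanti k])
    linarith [Real.sqrt_nonneg (2 * (E 0 + C) / P.lam)]

/-- Along a run, the gradient norm of the augmented Lagrangian is controlled by the primal
increments of the last two sweeps. -/
theorem Problem.exists_gradNorm_sq_le (hlam : 0 < P.lam) (hmu : 0 < P.mu)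
    (hσ : P.ActivationAssumption ψ₀ ψ₁ ψ₂) (hβ : P.PenaltyAssumption ψ₀ ψ₁ ψ₂ Vmax)
    (hω : P.ProximalAssumption ψ₀ ψ₁ ψ₂ Vmax ω e' e)
    (hx : ∀ k, P.LocalStep (ω k) (x k) (x (k + 1)))
    (hV : ∀ k (i : Fin H), ‖(x k).V i‖ ≤ Vmax i.succ) :
    ∃ K, 0 ≤ K ∧ ∀ k, P.gradNorm (x (k + 2)) ^ 2
      ≤ K * (primalSq (x k) (x (k + 1)) + primalSq (x (k + 1)) (x (k + 2))) := by
  have hβ0 := hβ.β_pos hσ hmu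
  have hβN : 0 < P.βN := one_pos.trans hβ.βN
  have hX := hβ.Vmax_zero.le
  have hω0 : ∀ k i, 0 ≤ ω k i := fun k i => (hω.ω_pos k i).le
  obtain ⟨S, hS0, hS, hW, hWN, hVN⟩ := P.exists_primal_bounds hlam hmu hσ hβ hω hx hV
  have hD : ∀ k, primalSq (x k) (x (k + 1)) ≤ S := fun k =>
    (Finset.single_le_sum (f := fun k => primalSq (x k) (x (k + 1)))
      (fun _ _ => primalSq_nonneg _ _) (Finset.self_mem_range_succ k)).trans (hS k)
  obtain ⟨Ω, hΩ0, hΩ⟩ := exists_forall_le fun i => P.ωmax ψ₀ ψ₁ ψ₂ Vmax i (e' i) (e i)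
  have hωΩ : ∀ k i, ω k i ≤ Ω := fun k i => (hω.upper k i).le.trans (hΩ i)
  obtain ⟨M, hM0, hM⟩ := exists_forall_le fun i => P.modulus ψ₀ ψ₁ ψ₂ Vmax i
  obtain ⟨β, hβ1, hβ2⟩ := exists_forall_le P.β
  obtain ⟨β', hβ1', hβ2'⟩ := exists_forall_le fun i => 1 / P.β i
  obtain ⟨V, hV1, hV2⟩ := exists_forall_le Vmax
  obtain ⟨T, hT1, hT2⟩ := exists_forall_le fun i => P.dualBound ψ₀ ψ₁ Vmax i
  have hψ := hσ.pos₁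
  have hNinv : 0 ≤ 1 / P.βN := by positivity
  have hΩS : 0 ≤ Ω * √S := by positivity
  -- A sum of nonnegative bounds dominates each of them. `S` serves the weights and the output
  -- multiplier, `T + Ω * √S` the hidden multipliers.
  set B := ψ₁ + P.mu + β + β' + P.βN + 1 / P.βN + Ω + S + V + T + Ω * √S with hBdef
  have hB : 0 ≤ B := by positivity
  have hΛ : ∀ k i, ‖(x (k + 1)).Λ i‖ ≤ B := fun k i => by
    have h1 := (hx k).norm_dual_le hσ hmu.le hX (hV _) (hV _) i (hω0 k i)
    have h2 : ω k i * ‖(x (k + 1)).U i - (x k).U i‖ ≤ Ω * √S :=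
      mul_le_mul (hωΩ k i) (Real.le_sqrt_of_sq_le ((norm_U_sub_sq_le _ _ i).trans (hD k)))
        (norm_nonneg _) hΩ0
    linarith [hT2 i]
  have hΛN : ∀ k, ‖(x (k + 1)).ΛN‖ ≤ B := fun k => by
    rw [(hx k).dualN_eq]
    linarith [hVN k]
  -- The `1` covers primal increments, the rest the four terms of `norm_dual_sub_sq_le`, so one `η`
  -- bounds all increments.
  set c := 1 + 4 * ((M + Ω) ^ 2 + P.mu ^ 2 * ψ₁ ^ 2) with hcdef
  have hc0 : 0 ≤ c := by positivity
  have hc1 : 1 ≤ c := by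
    have : 0 ≤ 4 * ((M + Ω) ^ 2 + P.mu ^ 2 * ψ₁ ^ 2) := by positivity
    linarith
  refine ⟨gradConst H B ^ 2 * c, by positivity, fun k => ?_⟩
  have hD1 := primalSq_nonneg (x k) (x (k + 1))
  have hD2 := primalSq_nonneg (x (k + 1)) (x (k + 2))
  set D1 := primalSq (x k) (x (k + 1)) with hD1def
  set D2 := primalSq (x (k + 1)) (x (k + 2)) with hD2def
  have hprim : ∀ {t : ℝ}, t ^ 2 ≤ D2 → t ≤ √(c * (D1 + D2)) := fun ht =>
    Real.le_sqrt_of_sq_le (by nlinarith)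
  have hincr : IncrBounds (√(c * (D1 + D2))) (x (k + 1)) (x (k + 2)) := by
    refine ⟨fun i => hprim (norm_U_sub_sq_le _ _ i), fun i => hprim (norm_V_sub_sq_le _ _ i),
      hprim (norm_VN_sub_sq_le _ _), fun i => Real.le_sqrt_of_sq_le ?_, ?_⟩
    · refine ((hx k).norm_dual_sub_sq_le hσ hmu.le hX (hV _) (hV _) (hx (k + 1)) i (hω0 _ i)
        (hω0 _ i)).trans ?_
      have hm := (hβ.modulus_pos hσ hmu i).le
      have h1 : (P.modulus ψ₀ ψ₁ ψ₂ Vmax i + ω (k + 1) i) ^ 2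
          * ‖(x (k + 2)).U i - (x (k + 1)).U i‖ ^ 2 ≤ (M + Ω) ^ 2 * D2 :=
        mul_le_mul (pow_le_pow_left₀ (add_nonneg hm (hω0 _ i)) (add_le_add (hM i) (hωΩ _ i)) 2)
          (norm_U_sub_sq_le _ _ i) (sq_nonneg _) (sq_nonneg _)
      have h2 : ω k i ^ 2 * ‖(x (k + 1)).U i - (x k).U i‖ ^ 2 ≤ (M + Ω) ^ 2 * D1 :=
        mul_le_mul (pow_le_pow_left₀ (hω0 _ i) ((hωΩ _ i).trans (by linarith)) 2)
          (norm_U_sub_sq_le _ _ i) (sq_nonneg _) (sq_nonneg _)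
      have h3 : ‖layer P.X (x (k + 2)) i.castSucc - layer P.X (x (k + 1)) i.castSucc‖ ^ 2 ≤ D2 := by
        have := norm_layer_sub_le P.X (x := x (k + 1)) (y := x (k + 2)) (Real.sqrt_nonneg D2)
          (fun i => Real.le_sqrt_of_sq_le (norm_V_sub_sq_le _ _ i)) i.castSucc
        calc _ ≤ √D2 ^ 2 := pow_le_pow_left₀ (norm_nonneg _) this 2
          _ = D2 := Real.sq_sqrt hD2
      have h4 := norm_V_sub_sq_le (x k) (x (k + 1)) i
      have hp : 0 ≤ P.mu ^ 2 * ψ₁ ^ 2 := by positivity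
      have h5 := mul_le_mul_of_nonneg_left h3 hp
      have h6 := mul_le_mul_of_nonneg_left h4 hp
      rw [hcdef]
      linarith
    · rw [(hx (k + 1)).dualN_eq, (hx k).dualN_eq, sub_sub_sub_cancel_right]
      exact hprim (norm_VN_sub_sq_le _ _)
  have hbounds : P.StepBounds ψ₁ (ω (k + 1)) B (x (k + 1)) (x (k + 2)) :=
    { ψ₁ := by linarith
      mu := by linarith
      β := fun i => by linarith [hβ2 i]
      β_inv := fun i => by linarith [hβ2' i]
      βN := by linarith
      βN_inv := by linarith
      ω := fun i => by linarith [hωΩ (k + 1) i]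
      W := fun i => by linarith [hW (k + 1) i]
      WN := by linarith [hWN (k + 1)]
      layer := fun j => by linarith [norm_layer_le hX (hV (k + 1)) j, hV2 j]
      Λ := hΛ k
      Λ' := hΛ (k + 1)
      ΛN := hΛN k
      ΛN' := hΛN (k + 1) }
  have := (hx (k + 1)).gradNorm_le hσ hmu.le hβ0 hβN (hω0 _) hB (Real.sqrt_nonneg _) hbounds hincr
  calc P.gradNorm (x (k + 2)) ^ 2 ≤ (gradConst H B * √(c * (D1 + D2))) ^ 2 :=
        pow_le_pow_left₀ (norm_nonneg _) this 2
    _ = _ := by rw [mul_pow, Real.sq_sqrt (by positivity)]; ring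

theorem Problem.exists_sum_gradNorm_sq_le (hlam : 0 < P.lam) (hmu : 0 < P.mu)
    (hσ : P.ActivationAssumption ψ₀ ψ₁ ψ₂) (hβ : P.PenaltyAssumption ψ₀ ψ₁ ψ₂ Vmax)
    (hω : P.ProximalAssumption ψ₀ ψ₁ ψ₂ Vmax ω e' e)
    (hx : ∀ k, P.LocalStep (ω k) (x k) (x (k + 1)))
    (hV : ∀ k (i : Fin H), ‖(x k).V i‖ ≤ Vmax i.succ) :
    ∃ S, ∀ k, ∑ l ∈ Finset.Icc 1 k, P.gradNorm (x l) ^ 2 ≤ S := by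
  obtain ⟨B, hB0, hB, -⟩ := P.exists_primal_bounds hlam hmu hσ hβ hω hx hV
  obtain ⟨K, hK0, hK⟩ := P.exists_gradNorm_sq_le hlam hmu hσ hβ hω hx hV
  -- The gradient estimate needs two preceding sweeps, so `x 1` is counted separately; each
  -- increment occurs in at most two estimates, hence `2 * B`.
  refine ⟨P.gradNorm (x 1) ^ 2 + K * (2 * B), fun k => ?_⟩
  -- One extra term is allowed, so that the term of `x 1` can be split off even for `k = 0`.
  have h1 : ∑ l ∈ Finset.Icc 1 k, P.gradNorm (x l) ^ 2
      ≤ ∑ l ∈ Finset.range (k + 1), P.gradNorm (x (l + 1)) ^ 2 := by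
    rw [Finset.sum_range_succ, Finset.range_eq_Ico,
      Finset.sum_Ico_add' (fun l => P.gradNorm (x l) ^ 2), zero_add]
    exact le_add_of_nonneg_right (sq_nonneg _)
  have h2 : ∑ l ∈ Finset.range k, primalSq (x l) (x (l + 1)) ≤ B :=
    (Finset.sum_le_sum_of_subset_of_nonneg (Finset.range_mono k.le_succ)
      fun _ _ _ => primalSq_nonneg _ _).trans (hB k)
  have h3 : ∑ l ∈ Finset.range k, primalSq (x (l + 1)) (x (l + 2)) ≤ B := by
    have := hB k
    rw [Finset.sum_range_succ'] at this
    linarith [primalSq_nonneg (x 0) (x (0 + 1))]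
  refine h1.trans ?_
  rw [Finset.sum_range_succ', add_comm]
  refine add_le_add le_rfl ((Finset.sum_le_sum fun l _ => hK l).trans ?_)
  rw [← Finset.mul_sum, Finset.sum_add_distrib]
  exact mul_le_mul_of_nonneg_left (by linarith) hK0

end Run

/-! ### Square summability gives the rate -/

/-- By Cauchy-Schwarz the sum of `k` terms is at most `√(k * S)`; dividing by `k` leaves `√S / √k`.
-/
theorem avgUpTo_le_of_sum_sq_le {f : ℕ → ℝ} {S : ℝ} {k : ℕ} (hk : 1 ≤ k)
    (hS : ∑ l ∈ Finset.Icc 1 k, f l ^ 2 ≤ S) : avgUpTo f k ≤ √S / √k := by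
  have hk0 : (0 : ℝ) < k := by exact_mod_cast hk
  have h1 := sq_sum_le_card_mul_sum_sq (s := Finset.Icc 1 k) (f := f)
  rw [Nat.card_Icc, Nat.add_sub_cancel] at h1
  have h2 : ∑ l ∈ Finset.Icc 1 k, f l ≤ √(k * S) :=
    Real.le_sqrt_of_sq_le (h1.trans (mul_le_mul_of_nonneg_left hS hk0.le))
  rw [Real.sqrt_mul hk0.le] at h2
  rw [avgUpTo, le_div_iff₀ (Real.sqrt_pos.mpr hk0)]
  calc 1 / (k : ℝ) * (∑ l ∈ Finset.Icc 1 k, f l) * √k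
      ≤ 1 / (k : ℝ) * (√k * √S) * √k := by gcongr
    _ = (√k * √k) / k * √S := by ring
    _ = √S := by rw [Real.mul_self_sqrt hk0.le, div_self hk0.ne', one_mul]

theorem minUpTo_le_avgUpTo (f : ℕ → ℝ) {k : ℕ} (hk : 1 ≤ k) : minUpTo f k hk ≤ avgUpTo f k := by
  have hk0 : (0 : ℝ) < k := by exact_mod_cast hk
  have h := Finset.card_nsmul_le_sum (Finset.Icc 1 k) f (minUpTo f k hk)
    fun l hl => Finset.inf'_le f hl
  rw [Nat.card_Icc, Nat.add_sub_cancel, nsmul_eq_mul] at h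
  rw [avgUpTo, one_div_mul_eq_div, le_div_iff₀ hk0]
  linarith

end ResNetADMM

end

/-! ### The rate for both algorithms -/

theorem mainTheorem4 (H d q n : ℕ) (P : ResNetADMM.Problem H d q n)
    (hlam : 0 < P.lam) (hmu : 0 < P.mu)
    (ψ₀ ψ₁ ψ₂ : ℝ) (Vmax : Fin (H + 1) → ℝ) (ω : ℕ → Fin H → ℝ) (e' e : Fin H → ℝ)
    (hσ : P.ActivationAssumption ψ₀ ψ₁ ψ₂)
    (hβ : P.PenaltyAssumption ψ₀ ψ₁ ψ₂ Vmax)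
    (hω : P.ProximalAssumption ψ₀ ψ₁ ψ₂ Vmax ω e' e)
    (x : ℕ → ResNetADMM.Vars H d q n)
    (hx : P.IsSerialRun ω x ∨ P.IsParallelRun ω x)
    (hV : ∀ k i, ‖(x k).V i‖ ≤ Vmax i.succ) :
    (∃ c : ℝ, 0 < c ∧ ∀ k : ℕ, 1 ≤ k →
      ResNetADMM.avgUpTo (fun l => P.gradNorm (x l)) k ≤ c / √(k : ℝ)) ∧
    (∃ c : ℝ, 0 < c ∧ ∀ (k : ℕ) (hk : 1 ≤ k),
      ResNetADMM.minUpTo (fun l => P.gradNorm (x l)) k hk ≤ c / √(k : ℝ)) := by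
  have hloc : ∀ k, P.LocalStep (ω k) (x k) (x (k + 1)) := by
    rcases hx with hx | hx
    · exact fun k => (hx.step k).localStep
    · exact fun k => (hx.step k).localStep (fun i => (hβ.β_pos hσ hmu i).ne')
        (one_pos.trans hβ.βN).ne'
  obtain ⟨S, hS⟩ := P.exists_sum_gradNorm_sq_le hlam hmu hσ hβ hω hloc hV
  -- The `+ 1` makes the constant positive even when `√S = 0`.
  have hrate : ∀ k : ℕ, 1 ≤ k →
      ResNetADMM.avgUpTo (fun l => P.gradNorm (x l)) k ≤ (√S + 1) / √(k : ℝ) := fun k hk =>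
    (ResNetADMM.avgUpTo_le_of_sum_sq_le hk (hS k)).trans
      (div_le_div_of_nonneg_right (by linarith) (Real.sqrt_nonneg _))
  exact ⟨⟨√S + 1, by positivity, hrate⟩, ⟨√S + 1, by positivity, fun k hk =>
    (ResNetADMM.minUpTo_le_avgUpTo _ hk).trans (hrate k hk)⟩⟩
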